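/- Let $d\ge 1$, $\delta\in(0,1)$, $K>0$. Write $x=(x^1,x')\in\mathbb R^d$ with $x^1\in\mathbb R$, $x'\in\mathbb R^{d-1}$, and $L_2=L_2(\mathbb R^d)$, $W_2^2=W_2^2(\mathbb R^d)$ (the Sobolev space of real functions with weak derivatives up to order $2$ in $L_2$). Consider $$Lu=\sum_{j,k=1}^d a^{jk}(x)u_{x^jx^k}+\sum_{j=1}^d b^j(x)u_{x^j}+c(x)u,$$ where $a^{jk},b^j,c$ are measurable real functions on $\mathbb R^d$ such that $a^{jk}=a^{kj}$, $|b^j|\le K$, $|c|\le K$, and $$\delta|\vartheta|^2\le\sum_{j,k=1}^d a^{jk}(x)\vartheta^j\vartheta^k\le\delta^{-1}|\vartheta|^2\qquad\text{for all }x,\vartheta\in\mathbb R^d .$$ (i) Suppose the $a^{jk}$ are independent of $x'$. Then there are constants $\lambda_0\ge 0$ and $N\ge 0$, depending only on $d,\delta,K$, such that for any $\lambda>\lambda_0$ and $f\in L_2$ there exists a unique $u\in W_2^2$ satisfying $Lu-\lambda u=f$, and such that for any $\lambda\ge\lambda_0$ and $u\in W_2^2$ $$\lambda\|u\|_{L_2}+\sqrt{\lambda}\,\|u_x\|_{L_2}+\|u_{xx}\|_{L_2}\le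 N\|Lu-\lambda u\|_{L_2}.\tag{1}$$ (ii) Suppose instead that the $a^{jk}(x^1,x')$ are uniformly continuous in $x'$ uniformly in $x^1$: $|a^{jk}(x^1,x')-a^{jk}(x^1,y')|\le\omega(|x'-y'|)$ for all $j,k,x^1,x',y'$, where $\omega:[0,\infty)\to\mathbb R$ satisfies $\omega(r)\to0=\omega(0)$ as $r\downarrow0$. Then the same conclusions hold, with $N$ depending only on $d,\delta,K$ and $\lambda_0\ge0$ depending only on $d,\delta,K,\omega$. -/

import Mathlib

open MeasureTheory Filter Topology
open scoped ContDiff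

/-- The space `ℝ^d` with `d = n + 1 ≥ 1`, the Euclidean norm and Lebesgue measure.
The coordinate `x^1` is `x 0`, and `x' ∈ ℝ^{d-1}` consists of the remaining `n` coordinates. -/
abbrev Rd (n : ℕ) : Type := EuclideanSpace ℝ (Fin (n + 1))

/-- Real-valued `L_2(ℝ^d)`. -/
abbrev L2Rd (n : ℕ) : Type := Lp ℝ 2 (volume : Measure (Rd n))

/-- `v ∈ L_2` is the weak (distributional) partial derivative of `u ∈ L_2` in the `i`-th
coordinate: `∫ u φ_{x^i} dx = - ∫ v φ dx` for every `φ ∈ C_0^∞(ℝ^d)`. -/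
def IsWeakPartial {n : ℕ} (i : Fin (n + 1)) (u v : L2Rd n) : Prop :=
  ∀ φ : Rd n → ℝ, ContDiff ℝ ∞ φ → HasCompactSupport φ →
    ∫ x, u x * fderiv ℝ φ x (EuclideanSpace.single i 1) = -∫ x, v x * φ x

/-- The Sobolev space `W_2^2(ℝ^d)`: an element is a function `u ∈ L_2` which has weak first
derivatives `u_{x^j}` and weak second derivatives `u_{x^j x^k}` in `L_2`. The derivatives are
recorded as fields; they are determined by `u`, see `W22.ext_toL2`. -/
structure W22 (n : ℕ) where
  toL2 : L2Rd n
  grad : Fin (n + 1) → L2Rd n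
  hess : Fin (n + 1) → Fin (n + 1) → L2Rd n
  isWeakPartial_grad : ∀ j, IsWeakPartial j toL2 (grad j)
  isWeakPartial_hess : ∀ j k, IsWeakPartial k (grad j) (hess j k)

theorem IsWeakPartial.unique {n : ℕ} {i : Fin (n + 1)} {u v w : L2Rd n}
    (hv : IsWeakPartial i u v) (hw : IsWeakPartial i u w) : v = w := by
  apply Lp.ext
  refine ae_eq_of_integral_contDiff_smul_eq
    ((Lp.memLp v).locallyIntegrable (by norm_num))
    ((Lp.memLp w).locallyIntegrable (by norm_num)) ?_
  intro φ hφ hc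
  have h := (hv φ hφ hc).symm.trans (hw φ hφ hc)
  simpa [mul_comm] using h

/-- Two elements of `W_2^2(ℝ^d)` are equal as soon as they are equal in `L_2`. -/
theorem W22.ext_toL2 {n : ℕ} {u v : W22 n} (h : u.toL2 = v.toL2) : u = v := by
  obtain ⟨u, g, H, hg, hH⟩ := u
  obtain ⟨v, g', H', hg', hH'⟩ := v
  obtain rfl : u = v := h
  obtain rfl : g = g' := funext fun j => (hg j).unique (hg' j)
  obtain rfl : H = H' := funext fun j => funext fun k => (hH j k).unique (hH' j k)
  rfl

/-- `‖u_x‖_{L_2}`, the `L_2`-norm of the Euclidean length of the gradient: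
`‖u_x‖² = ∫ ∑_j |u_{x^j}|² dx = ∑_j ‖u_{x^j}‖²`. -/
noncomputable def W22.gradNorm {n : ℕ} (u : W22 n) : ℝ :=
  √(∑ j, ‖u.grad j‖ ^ 2)

/-- `‖u_{xx}‖_{L_2}`, the `L_2`-norm of the Euclidean length of the Hessian matrix:
`‖u_{xx}‖² = ∫ ∑_{j,k} |u_{x^j x^k}|² dx = ∑_{j,k} ‖u_{x^j x^k}‖²`. -/
noncomputable def W22.hessNorm {n : ℕ} (u : W22 n) : ℝ :=
  √(∑ j, ∑ k, ‖u.hess j k‖ ^ 2)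

/-- The operator `Lu = a^{jk} u_{x^j x^k} + b^j u_{x^j} + c u` for `u ∈ W_2^2(ℝ^d)`
(a function defined almost everywhere). -/
noncomputable def ellipticOp {n : ℕ} (a : Rd n → Matrix (Fin (n + 1)) (Fin (n + 1)) ℝ)
    (b : Rd n → Fin (n + 1) → ℝ) (c : Rd n → ℝ) (u : W22 n) : Rd n → ℝ :=
  fun x => ∑ j, ∑ k, a x j k * u.hess j k x + ∑ j, b x j * u.grad j x + c x * u.toL2 x

/-- The standing assumption on the coefficients: they are (Lebesgue) measurable, `a` is
symmetric and uniformly elliptic with constant `δ`, and `b^j` and `c` are bounded by `K`. -/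
structure CoeffAssumption {n : ℕ} (δ K : ℝ)
    (a : Rd n → Matrix (Fin (n + 1)) (Fin (n + 1)) ℝ)
    (b : Rd n → Fin (n + 1) → ℝ) (c : Rd n → ℝ) : Prop where
  measurable_a : ∀ j k, AEMeasurable (fun x => a x j k) volume
  measurable_b : ∀ j, AEMeasurable (fun x => b x j) volume
  measurable_c : AEMeasurable c volume
  symm_a : ∀ x j k, a x j k = a x k j
  bound_b : ∀ x j, |b x j| ≤ K
  bound_c : ∀ x, |c x| ≤ K
  elliptic : ∀ (x : Rd n) (θ : Fin (n + 1) → ℝ),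
    δ * ∑ j, θ j ^ 2 ≤ ∑ j, ∑ k, a x j k * θ j * θ k ∧
    ∑ j, ∑ k, a x j k * θ j * θ k ≤ δ⁻¹ * ∑ j, θ j ^ 2

/-- `a` is independent of `x'`, that is, depends on `x^1` only. -/
def IndepOfTail {n : ℕ} (a : Rd n → Matrix (Fin (n + 1)) (Fin (n + 1)) ℝ) : Prop :=
  ∀ x y : Rd n, x 0 = y 0 → a x = a y

/-- `a` has modulus of continuity `w` in `x'`, uniformly in `x^1`:
`|a^{jk}(x^1, x') - a^{jk}(x^1, y')| ≤ w(|x' - y'|)`. Note that `dist x y = |x' - y'|` for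
points with the same first coordinate. -/
def HasTailModulus {n : ℕ} (w : ℝ → ℝ)
    (a : Rd n → Matrix (Fin (n + 1)) (Fin (n + 1)) ℝ) : Prop :=
  ∀ x y : Rd n, x 0 = y 0 → ∀ j k, |a x j k - a y j k| ≤ w (dist x y)

/-!
The estimate in the second assertion contains the one in the first, where the modulus of continuity
is zero, and both existence statements follow from the estimate by the method of continuity.

**The estimate.** Divide the equation by `a^{11}`, so that the leading coefficients become
`α^{jk}` with `α^{11} = 1` and `λ` becomes `λρ`, and test the resulting right-hand side `G` with
`∑_{m ≠ 1} u_{x^m x^m} - λu`. If the coefficients do not depend on `x'`, then integrating by parts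
gives
`∫ α^{jk} u_{x^j x^k} u_{x^m x^m} = ∫ α^{jk} u_{x^j x^m} u_{x^k x^m}` and
`-λ ∫ α^{jk} u_{x^j x^k} u = λ ∫ α^{jk} u_{x^j} u_{x^k}`: for `(j, k) ≠ (1, 1)` a derivative in `x'`
can be moved, and for `j = k = 1` the coefficient is constant. Ellipticity then bounds all second
derivatives except `u_{x^1 x^1}`, together with `√λ u_x` and `λu`, and `u_{x^1 x^1}` is read off
from the equation (`AbstractCoeff.sqrt_jetEnergy_le`). Neither a Fourier transform in `x'` nor a
partition of unity is needed.

If the coefficients are uniformly continuous in `x'`, each of them is replaced by its mean over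
short translations along the coordinate directions involved. The mean is close to the coefficient
and Lipschitz in these directions, so the integrations by parts hold with an error
`κ ‖u_xx‖² + M ‖u_x‖ ‖u_xx‖` (`IsometryGroup.SlowlyVarying.abs_inner_add_inner_le` and
`IsometryGroup.SlowlyVarying.abs_inner_sub_inner_le`). The constant `κ` is small by the choice of
the averaging length, and the second term is absorbed for large `λ`, as are the lower order terms of
`L`. Averages are taken of multiplication operators conjugated by translations; these depend
continuously on the translation in operator norm, which makes questions of measurability trivial.
Integration by parts is carried out on difference quotients, for which the only input is that weak
derivatives generate the translation groups (`IsWeakPartial.hasGenerator`).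

**Existence.** `W_2^2` is a closed space of 2-jets, hence a Banach space. The estimate is uniform on
the segment from `Δ` to `L`, so surjectivity of `L - λ` reduces to that of `Δ - λ`
(`ContinuousLinearMap.surjective_of_continuity`). The range of the latter is closed by the estimate
and contains all Schwartz functions, by the Fourier transform
(`SchwartzMap.exists_laplacian_sub_smul_eq`).
-/

/-! ### Isometry groups and commutators with slowly varying operators -/

/-- A one-parameter group of linear isometries of a real Hilbert space; no continuity in the
parameter is required. -/
structure IsometryGroup (H : Type*) [NormedAddCommGroup H] [InnerProductSpace ℝ H] where
  toFun : ℝ → H →L[ℝ] H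
  map_zero : toFun 0 = 1
  map_add : ∀ s t, toFun (s + t) = toFun s * toFun t
  norm_map : ∀ s v, ‖toFun s v‖ = ‖v‖

namespace IsometryGroup

variable {H : Type*} [NormedAddCommGroup H] [InnerProductSpace ℝ H]

instance : CoeFun (IsometryGroup H) (fun _ => ℝ → H →L[ℝ] H) := ⟨toFun⟩

theorem mul_neg (T : IsometryGroup H) (s : ℝ) : T s * T (-s) = 1 := by
  rw [← T.map_add, add_neg_cancel, T.map_zero]

theorem neg_mul (T : IsometryGroup H) (s : ℝ) : T (-s) * T s = 1 := by
  rw [← T.map_add, neg_add_cancel, T.map_zero]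

theorem apply_neg_apply (T : IsometryGroup H) (s : ℝ) (v : H) : T s (T (-s) v) = v := by
  simpa using congrArg (fun A : H →L[ℝ] H => A v) (T.mul_neg s)

theorem neg_apply_apply (T : IsometryGroup H) (s : ℝ) (v : H) : T (-s) (T s v) = v := by
  simpa using congrArg (fun A : H →L[ℝ] H => A v) (T.neg_mul s)

theorem inner_map_map (T : IsometryGroup H) (s : ℝ) (v w : H) :
    inner ℝ (T s v) (T s w) = inner ℝ v w :=
  LinearIsometry.inner_map_map ⟨(T s).toLinearMap, T.norm_map s⟩ v w

theorem inner_map_neg (T : IsometryGroup H) (s : ℝ) (v w : H) :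
    inner ℝ v (T (-s) w) = inner ℝ (T s v) w := by
  rw [← T.inner_map_map s v, T.apply_neg_apply]

/-- `v` is the derivative of the orbit `s ↦ T s u` at `s = 0`: the pair `(u, v)` lies in the graph
of the generator of `T`. -/
def HasGenerator (T : IsometryGroup H) (u v : H) : Prop :=
  Tendsto (fun h : ℝ => h⁻¹ • (T h u - u)) (𝓝[≠] 0) (𝓝 v)

theorem HasGenerator.neg {T : IsometryGroup H} {u v : H} (h : T.HasGenerator u v) :
    Tendsto (fun h : ℝ => h⁻¹ • (T (-h) u - u)) (𝓝[≠] 0) (𝓝 (-v)) := by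
  have hn : Tendsto (fun h : ℝ => -h) (𝓝[≠] 0) (𝓝[≠] 0) := by
    have := (Homeomorph.neg ℝ).isEmbedding.map_nhdsWithin_eq ({0}ᶜ : Set ℝ) 0
    simp only [Homeomorph.coe_neg, neg_zero, Set.image_neg_eq_neg] at this
    refine le_of_eq (this.trans ?_)
    congr 1
    ext x
    simp
  have h2 := (Tendsto.comp h hn).neg
  refine h2.congr fun s => ?_
  simp only [Function.comp, inv_neg, neg_smul, neg_neg]

theorem HasGenerator.diffQuot {T S : IsometryGroup H} {u v : H} (h : T.HasGenerator u v)
    (hc : ∀ s t, T s * S t = S t * T s) (t c : ℝ) :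
    T.HasGenerator (c • (S t u - u)) (c • (S t v - v)) := by
  have h2 := ((((S t).continuous.tendsto v).comp h).sub h).const_smul c
  refine h2.congr fun s => ?_
  have e : T s (S t u) = S t (T s u) := congrArg (fun A : H →L[ℝ] H => A u) (hc s t)
  simp only [Function.comp, map_smul, map_sub, e]
  module

/-- Conjugation by `T s`. For a group of translations it translates multiplication operators. -/
noncomputable def conj (T : IsometryGroup H) (s : ℝ) : (H →L[ℝ] H) →L[ℝ] (H →L[ℝ] H) :=
  ContinuousLinearMap.mulLeftRight ℝ (H →L[ℝ] H) (T s) (T (-s))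

theorem conj_apply (T : IsometryGroup H) (s : ℝ) (A : H →L[ℝ] H) :
    T.conj s A = T s * A * T (-s) := rfl

theorem norm_conj_le (T : IsometryGroup H) (s : ℝ) (A : H →L[ℝ] H) : ‖T.conj s A‖ ≤ ‖A‖ := by
  refine ContinuousLinearMap.opNorm_le_bound _ (norm_nonneg _) fun v => ?_
  rw [conj_apply]
  simp only [mul_apply_eq_comp]
  rw [T.norm_map]
  exact (A.le_opNorm _).trans_eq (by rw [T.norm_map])

theorem conj_add (T : IsometryGroup H) (s t : ℝ) (A : H →L[ℝ] H) :
    T.conj (s + t) A = T.conj s (T.conj t A) := by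
  rw [conj_apply, conj_apply, conj_apply, T.map_add,
    show -(s + t) = -t + -s by ring, T.map_add]
  simp only [mul_assoc]

theorem conj_one (T : IsometryGroup H) (s : ℝ) : T.conj s 1 = 1 := by
  rw [conj_apply, mul_one, T.mul_neg]

theorem conj_comm {T S : IsometryGroup H} (hc : ∀ s t, T s * S t = S t * T s) (s t : ℝ)
    (A : H →L[ℝ] H) : T.conj s (S.conj t A) = S.conj t (T.conj s A) := by
  simp only [conj_apply]
  calc T s * (S t * A * S (-t)) * T (-s) = (T s * S t) * A * (S (-t) * T (-s)) := by
        simp only [mul_assoc]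
    _ = (S t * T s) * A * (T (-s) * S (-t)) := by rw [hc, hc]
    _ = _ := by simp only [mul_assoc]

/-- Summation by parts for difference quotients; the error is the commutator of `A` with the
group. -/
theorem abs_inner_diff_le {T : IsometryGroup H} {A : H →L[ℝ] H} {M : ℝ}
    (hM : ∀ s, ‖T.conj s A - A‖ ≤ M * |s|)
    (h : ℝ) (v w : H) :
    |inner ℝ (A (T h v - v)) w - inner ℝ (A v) (T (-h) w - w)| ≤ M * |h| * (‖v‖ * ‖w‖) := by
  have e : inner ℝ (A (T h v - v)) w - inner ℝ (A v) (T (-h) w - w)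
      = -inner ℝ ((T.conj h A - A) (T h v)) w := by
    rw [map_sub, inner_sub_left, inner_sub_right, T.inner_map_neg, sub_apply,
      inner_sub_left, conj_apply]
    simp only [mul_apply_eq_comp, T.neg_apply_apply]
    ring
  rw [e, abs_neg]
  refine (abs_real_inner_le_norm _ _).trans ?_
  have h1 := (T.conj h A - A).le_opNorm (T h v)
  rw [T.norm_map] at h1
  have h2 := mul_le_mul_of_nonneg_right (hM h) (norm_nonneg v)
  calc _ ≤ (M * |h| * ‖v‖) * ‖w‖ := mul_le_mul_of_nonneg_right (h1.trans h2) (norm_nonneg _)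
    _ = _ := by ring

/-- Integration by parts against an operator which is Lipschitz along the group. -/
theorem abs_inner_add_inner_le_of_lipschitz {T : IsometryGroup H} {A : H →L[ℝ] H} {M : ℝ}
    (hM : ∀ s, ‖T.conj s A - A‖ ≤ M * |s|)
    {v v' w w' : H} (hv : T.HasGenerator v v') (hw : T.HasGenerator w w') :
    |inner ℝ (A v') w + inner ℝ (A v) w'| ≤ M * (‖v‖ * ‖w‖) := by
  have l1 : Tendsto (fun h : ℝ => |inner ℝ (A (h⁻¹ • (T h v - v))) w
      - inner ℝ (A v) (h⁻¹ • (T (-h) w - w))|) (𝓝[≠] 0)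
      (𝓝 |inner ℝ (A v') w - inner ℝ (A v) (-w')|) :=
    ((((A.continuous.tendsto _).comp hv).inner tendsto_const_nhds).sub
      (tendsto_const_nhds.inner hw.neg)).abs
  rw [inner_neg_right, sub_neg_eq_add] at l1
  refine le_of_tendsto l1 ?_
  filter_upwards [self_mem_nhdsWithin] with h hh
  have hh : h ≠ 0 := hh
  rw [map_smul, inner_smul_left, inner_smul_right]
  simp only [conj_trivial]
  rw [← mul_sub, abs_mul, abs_inv]
  have := abs_inner_diff_le hM h v w
  have hp : 0 < |h| := abs_pos.2 hh
  rw [inv_mul_le_iff₀ hp]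
  exact this.trans_eq (by ring)

/-- Double integration by parts `∫ γ U_k W_m = ∫ γ U_m W_k + …`. The third derivatives that would
occur in between are avoided by replacing `W_m` by difference quotients of `W`. -/
theorem abs_inner_sub_inner_le_of_lipschitz {T S : IsometryGroup H} {A : H →L[ℝ] H} {M : ℝ}
    (hc : ∀ s t, T s * S t = S t * T s)
    (hT : ∀ s, ‖T.conj s A - A‖ ≤ M * |s|)
    (hS : ∀ s, ‖S.conj s A - A‖ ≤ M * |s|) {u uT uS w wT wS : H}
    (huT : T.HasGenerator u uT) (huS : S.HasGenerator u uS)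
    (hwT : T.HasGenerator w wT) (hwS : S.HasGenerator w wS) :
    |inner ℝ (A uT) wS - inner ℝ (A uS) wT| ≤ M * (‖u‖ * (‖wS‖ + ‖wT‖)) := by
  have l1 : Tendsto (fun h : ℝ => |inner ℝ (A uT) (h⁻¹ • (S h w - w))
      + inner ℝ (A (h⁻¹ • (S (-h) u - u))) wT|) (𝓝[≠] 0)
      (𝓝 |inner ℝ (A uT) wS + inner ℝ (A (-uS)) wT|) :=
    ((tendsto_const_nhds.inner hwS).add
      (((A.continuous.tendsto _).comp huS.neg).inner tendsto_const_nhds)).abs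
  have l2 : Tendsto (fun h : ℝ => M * (‖u‖ * (‖h⁻¹ • (S h w - w)‖ + ‖wT‖))) (𝓝[≠] 0)
      (𝓝 (M * (‖u‖ * (‖wS‖ + ‖wT‖)))) :=
    ((hwS.norm.add tendsto_const_nhds).const_mul _).const_mul _
  rw [map_neg, inner_neg_left, ← sub_eq_add_neg] at l1
  refine le_of_tendsto_of_tendsto l1 l2 ?_
  filter_upwards [self_mem_nhdsWithin] with h hh
  have hh : h ≠ 0 := hh
  have hp : 0 < |h| := abs_pos.2 hh
  have b1 := abs_inner_add_inner_le_of_lipschitz hT huT (hwT.diffQuot hc h h⁻¹)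
  have b2 := abs_inner_diff_le hS (-h) u wT
  rw [neg_neg, abs_neg] at b2
  have b3 : |inner ℝ (A (h⁻¹ • (S (-h) u - u))) wT - inner ℝ (A u) (h⁻¹ • (S h wT - wT))|
      ≤ M * (‖u‖ * ‖wT‖) := by
    rw [map_smul, inner_smul_left, inner_smul_right]
    simp only [conj_trivial]
    rw [← mul_sub, abs_mul, abs_inv, inv_mul_le_iff₀ hp]
    exact b2.trans_eq (by ring)
  have b4 := abs_add_le (inner ℝ (A uT) (h⁻¹ • (S h w - w)) + inner ℝ (A u) (h⁻¹ • (S h wT - wT)))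
    (inner ℝ (A (h⁻¹ • (S (-h) u - u))) wT - inner ℝ (A u) (h⁻¹ • (S h wT - wT)))
  rw [show inner ℝ (A uT) (h⁻¹ • (S h w - w)) + inner ℝ (A u) (h⁻¹ • (S h wT - wT)) +
    (inner ℝ (A (h⁻¹ • (S (-h) u - u))) wT - inner ℝ (A u) (h⁻¹ • (S h wT - wT))) =
    inner ℝ (A uT) (h⁻¹ • (S h w - w)) + inner ℝ (A (h⁻¹ • (S (-h) u - u))) wT by ring] at b4
  refine b4.trans ((add_le_add b1 b3).trans_eq (by ring))

/-! ### Averaging an operator along a group -/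

/-- `A` varies slowly along `T`: its conjugates depend continuously on the parameter in operator
norm and stay within `κ` of `A` up to time `ε`. -/
structure SlowlyVarying (T : IsometryGroup H) (ε κ : ℝ) (A : H →L[ℝ] H) : Prop where
  tendsto : Tendsto (fun s => T.conj s A) (𝓝 0) (𝓝 A)
  norm_conj_sub_le : ∀ s, |s| ≤ ε → ‖T.conj s A - A‖ ≤ κ

theorem slowlyVarying_one (T : IsometryGroup H) {ε κ : ℝ} (hκ : 0 ≤ κ) :
    T.SlowlyVarying ε κ 1 where
  tendsto := by simp only [conj_one]; exact tendsto_const_nhds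
  norm_conj_sub_le s _ := by simpa [conj_one] using hκ

theorem SlowlyVarying.continuous {T : IsometryGroup H} {ε κ : ℝ} {A : H →L[ℝ] H}
    (h : T.SlowlyVarying ε κ A) : Continuous fun s => T.conj s A := by
  refine continuous_iff_continuousAt.2 fun s => ?_
  have h1 : Tendsto (fun t => T.conj (t - s) A) (𝓝 s) (𝓝 A) := by
    refine h.tendsto.comp ?_
    have : Tendsto (fun t : ℝ => t - s) (𝓝 s) (𝓝 (s - s)) :=
      (continuous_id.sub continuous_const).tendsto s
    simpa using this
  have h2 := ((T.conj s).continuous.tendsto A).comp h1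
  refine h2.congr fun t => ?_
  simp only [Function.comp]
  rw [← conj_add, add_sub_cancel]

/-- The mean of the conjugates of `A` by `T s` over `0 ≤ s ≤ ε`. -/
noncomputable def average (T : IsometryGroup H) (ε : ℝ) (A : H →L[ℝ] H) : H →L[ℝ] H :=
  ε⁻¹ • ∫ s in (0 : ℝ)..ε, T.conj s A

theorem norm_average_le (T : IsometryGroup H) {ε : ℝ} (A : H →L[ℝ] H) (hε : 0 < ε) :
    ‖T.average ε A‖ ≤ ‖A‖ := by
  rw [average, norm_smul, norm_inv, Real.norm_of_nonneg hε.le, inv_mul_le_iff₀ hε]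
  have := intervalIntegral.norm_integral_le_of_norm_le_const (a := 0) (b := ε) (C := ‖A‖)
    (f := fun s => T.conj s A) fun s _ => T.norm_conj_le s A
  rwa [sub_zero, abs_of_pos hε, mul_comm] at this

theorem abs_inner_sub_inner_le_opNorm (A B : H →L[ℝ] H) (v w : H) :
    |inner ℝ (A v) w - inner ℝ (B v) w| ≤ ‖B - A‖ * (‖v‖ * ‖w‖) := by
  rw [← inner_sub_left, ← sub_apply, norm_sub_rev B A, ← mul_assoc]
  exact (abs_real_inner_le_norm _ _).trans
    (mul_le_mul_of_nonneg_right ((A - B).le_opNorm v) (norm_nonneg w))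

variable [CompleteSpace H]

theorem SlowlyVarying.norm_average_sub_le {T : IsometryGroup H} {ε κ : ℝ} {A : H →L[ℝ] H}
    (h : T.SlowlyVarying ε κ A) (hε : 0 < ε) : ‖T.average ε A - A‖ ≤ κ := by
  have e : T.average ε A - A = ε⁻¹ • ∫ s in (0 : ℝ)..ε, (T.conj s A - A) := by
    rw [average, intervalIntegral.integral_sub (h.continuous.intervalIntegrable _ _)
      (by simp), intervalIntegral.integral_const, smul_sub, sub_zero, inv_smul_smul₀ hε.ne']
  rw [e, norm_smul, norm_inv, Real.norm_of_nonneg hε.le, inv_mul_le_iff₀ hε]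
  have := intervalIntegral.norm_integral_le_of_norm_le_const (a := 0) (b := ε) (C := κ)
    (f := fun s => T.conj s A - A) fun s hs => h.norm_conj_sub_le s (by
      rw [Set.uIoc_of_le hε.le] at hs
      rw [abs_of_pos hs.1]; exact hs.2)
  rwa [sub_zero, abs_of_pos hε, mul_comm] at this

theorem SlowlyVarying.norm_conj_average_sub_le {T : IsometryGroup H} {ε κ : ℝ} {A : H →L[ℝ] H}
    (h : T.SlowlyVarying ε κ A) (hε : 0 < ε) (s : ℝ) :
    ‖T.conj s (T.average ε A) - T.average ε A‖ ≤ 2 * ‖A‖ / ε * |s| := by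
  have hi : ∀ a b, IntervalIntegrable (fun s => T.conj s A) volume a b :=
    fun a b => h.continuous.intervalIntegrable a b
  have e : T.conj s (T.average ε A) - T.average ε A
      = ε⁻¹ • ((∫ t in ε..(ε + s), T.conj t A) - ∫ t in (0 : ℝ)..s, T.conj t A) := by
    rw [average, map_smul, ← ContinuousLinearMap.intervalIntegral_comp_comm _ (hi _ _), ← smul_sub]
    simp only [← conj_add]
    rw [intervalIntegral.integral_comp_add_left (fun t => T.conj t A) s, add_zero,
      intervalIntegral.integral_interval_sub_interval_comm (hi _ _) (hi _ _) (hi _ _), add_comm s ε,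
      intervalIntegral.integral_symm 0 s, intervalIntegral.integral_symm ε (ε + s)]
    congr 1
    abel
  have b : ∀ a : ℝ, ‖∫ t in a..(a + s), T.conj t A‖ ≤ ‖A‖ * |s| := fun a => by
    have := intervalIntegral.norm_integral_le_of_norm_le_const (a := a) (b := a + s) (C := ‖A‖)
      (f := fun s => T.conj s A) fun s _ => T.norm_conj_le s A
    rwa [add_sub_cancel_left] at this
  have b0 := b 0
  rw [zero_add] at b0
  rw [e, norm_smul, norm_inv, Real.norm_of_nonneg hε.le, inv_mul_le_iff₀ hε]
  refine (norm_sub_le _ _).trans ((add_le_add (b ε) b0).trans_eq ?_)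
  field_simp
  ring

theorem SlowlyVarying.norm_conj_average_sub_le_of_commute {T S : IsometryGroup H} {ε κ : ℝ}
    {A : H →L[ℝ] H} (h : T.SlowlyVarying ε κ A) (hε : 0 < ε)
    (hc : ∀ s t, T s * S t = S t * T s) (t : ℝ) :
    ‖S.conj t (T.average ε A) - T.average ε A‖ ≤ ‖S.conj t A - A‖ := by
  have hi := h.continuous.intervalIntegrable (μ := volume) 0 ε
  have hi2 : IntervalIntegrable (fun s => S.conj t (T.conj s A)) volume 0 ε :=
    ((S.conj t).continuous.comp h.continuous).intervalIntegrable _ _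
  have e : S.conj t (T.average ε A) - T.average ε A
      = ε⁻¹ • ∫ s in (0 : ℝ)..ε, T.conj s (S.conj t A - A) := by
    rw [average, map_smul, ← ContinuousLinearMap.intervalIntegral_comp_comm _ hi, ← smul_sub,
      ← intervalIntegral.integral_sub hi2 hi]
    congr 1
    refine intervalIntegral.integral_congr fun s _ => ?_
    rw [← conj_comm hc, map_sub]
  rw [e, norm_smul, norm_inv, Real.norm_of_nonneg hε.le, inv_mul_le_iff₀ hε]
  have := intervalIntegral.norm_integral_le_of_norm_le_const (a := 0) (b := ε)
    (C := ‖S.conj t A - A‖) (f := fun s => T.conj s (S.conj t A - A))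
    fun s _ => T.norm_conj_le s _
  rwa [sub_zero, abs_of_pos hε, mul_comm] at this

theorem SlowlyVarying.average_of_commute {T S : IsometryGroup H} {ε κ κ' : ℝ} {A : H →L[ℝ] H}
    (h : T.SlowlyVarying ε κ A) (h' : S.SlowlyVarying ε κ' A) (hε : 0 < ε)
    (hc : ∀ s t, T s * S t = S t * T s) : S.SlowlyVarying ε κ' (T.average ε A) where
  tendsto := by
    rw [tendsto_iff_norm_sub_tendsto_zero]
    exact squeeze_zero (fun _ => norm_nonneg _)
      (fun t => h.norm_conj_average_sub_le_of_commute hε hc t)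
      (tendsto_iff_norm_sub_tendsto_zero.1 h'.tendsto)
  norm_conj_sub_le s hs :=
    le_trans (h.norm_conj_average_sub_le_of_commute hε hc s) (h'.norm_conj_sub_le s hs)

/-- Integration by parts against a slowly varying operator: `A` is compared with its average, which
is Lipschitz along the group. -/
theorem SlowlyVarying.abs_inner_add_inner_le {T : IsometryGroup H} {ε κ : ℝ} {A : H →L[ℝ] H}
    (h : T.SlowlyVarying ε κ A) (hε : 0 < ε)
    {v v' w w' : H} (hv : T.HasGenerator v v') (hw : T.HasGenerator w w') :
    |inner ℝ (A v') w + inner ℝ (A v) w'| ≤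
      κ * (‖v'‖ * ‖w‖ + ‖v‖ * ‖w'‖) + 2 * ‖A‖ / ε * (‖v‖ * ‖w‖) := by
  have h1 := abs_inner_add_inner_le_of_lipschitz (h.norm_conj_average_sub_le hε) hv hw
  have h2 := fun x y => (abs_inner_sub_inner_le_opNorm A (T.average ε A) x y).trans
    (mul_le_mul_of_nonneg_right (h.norm_average_sub_le hε)
      (mul_nonneg (norm_nonneg x) (norm_nonneg y)))
  have h3 := h2 v' w
  have h4 := h2 v w'
  rw [abs_le] at h1 h3 h4 ⊢
  constructor <;> nlinarith [h1.1, h1.2, h3.1, h3.2, h4.1, h4.2]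

/-- Double integration by parts against an operator varying slowly along both groups, which is
averaged along both. -/
theorem SlowlyVarying.abs_inner_sub_inner_le {T S : IsometryGroup H} {ε κ : ℝ} {A : H →L[ℝ] H}
    (h : T.SlowlyVarying ε κ A) (h' : S.SlowlyVarying ε κ A) (hε : 0 < ε)
    (hc : ∀ s t, T s * S t = S t * T s)
    {u uT uS w wT wS : H}
    (huT : T.HasGenerator u uT) (huS : S.HasGenerator u uS)
    (hwT : T.HasGenerator w wT) (hwS : S.HasGenerator w wS) :
    |inner ℝ (A uT) wS - inner ℝ (A uS) wT| ≤
      2 * κ * (‖uT‖ * ‖wS‖ + ‖uS‖ * ‖wT‖) + 2 * ‖A‖ / ε * (‖u‖ * (‖wS‖ + ‖wT‖)) := by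
  set B := T.average ε A with hB
  have hSB : S.SlowlyVarying ε κ B := h.average_of_commute h' hε hc
  have hTB : ∀ s, ‖T.conj s B - B‖ ≤ 2 * ‖A‖ / ε * |s| := h.norm_conj_average_sub_le hε
  set C := S.average ε B with hC
  have hTC : ∀ s, ‖T.conj s C - C‖ ≤ 2 * ‖A‖ / ε * |s| := fun s =>
    (hSB.norm_conj_average_sub_le_of_commute hε (fun s t => (hc t s).symm) s).trans (hTB s)
  have hSC : ∀ s, ‖S.conj s C - C‖ ≤ 2 * ‖A‖ / ε * |s| := fun s => by
    refine (hSB.norm_conj_average_sub_le hε s).trans ?_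
    gcongr
    exact T.norm_average_le A hε
  have h1 := abs_inner_sub_inner_le_of_lipschitz hc hTC hSC
    huT huS hwT hwS
  have hAC : ‖C - A‖ ≤ 2 * κ := by
    calc ‖C - A‖ = ‖(C - B) + (B - A)‖ := by congr 1; abel
      _ ≤ κ + κ := (norm_add_le _ _).trans
        (add_le_add (hSB.norm_average_sub_le hε) (h.norm_average_sub_le hε))
      _ = 2 * κ := by ring
  have h2 := fun x y => (abs_inner_sub_inner_le_opNorm A C x y).trans
    (mul_le_mul_of_nonneg_right hAC (mul_nonneg (norm_nonneg x) (norm_nonneg y)))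
  have h3 := h2 uT wS
  have h4 := h2 uS wT
  rw [abs_le] at h1 h3 h4 ⊢
  constructor <;> nlinarith [h1.1, h1.2, h3.1, h3.2, h4.1, h4.2]

end IsometryGroup

/-! ### The a priori estimate for an abstract second order operator -/

section Energy

variable {H : Type*} [NormedAddCommGroup H]

/-- The square of the norm `(‖u_xx‖² + μ² ‖u_x‖² + μ⁴ ‖u‖²)^{1/2}`, where `μ = √λ`. -/
noncomputable def jetEnergy {n : ℕ} (μ : ℝ) (u : H) (g : Fin (n + 1) → H)
    (h : Fin (n + 1) → Fin (n + 1) → H) : ℝ :=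
  ∑ j, ∑ k, ‖h j k‖ ^ 2 + μ ^ 2 * ∑ j, ‖g j‖ ^ 2 + (μ ^ 2) ^ 2 * ‖u‖ ^ 2

/-- The part of `jetEnergy` without the row `h 0 k`; by the symmetry of `h` only
`h 0 0 = u_{x^1 x^1}` is lost. It is controlled by testing the equation, whereas `u_{x^1 x^1}` is
read off from the equation. -/
noncomputable def tailEnergy {n : ℕ} (μ : ℝ) (u : H) (g : Fin (n + 1) → H)
    (h : Fin (n + 1) → Fin (n + 1) → H) : ℝ :=
  ∑ m : Fin n, ∑ j, ‖h m.succ j‖ ^ 2 + μ ^ 2 * ∑ j, ‖g j‖ ^ 2 + (μ ^ 2) ^ 2 * ‖u‖ ^ 2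

variable {n : ℕ} {μ : ℝ} {u : H} {g : Fin (n + 1) → H}
  {h : Fin (n + 1) → Fin (n + 1) → H}

theorem jetEnergy_nonneg : 0 ≤ jetEnergy μ u g h := by
  unfold jetEnergy; positivity

theorem tailEnergy_nonneg : 0 ≤ tailEnergy μ u g h := by
  unfold tailEnergy; positivity

theorem norm_hess_le_sqrt_jetEnergy (j k : Fin (n + 1)) : ‖h j k‖ ≤ √(jetEnergy μ u g h) := by
  refine Real.le_sqrt_of_sq_le ?_
  have h1 := Finset.single_le_sum (f := fun k => ‖h j k‖ ^ 2) (fun _ _ => by positivity)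
    (Finset.mem_univ k)
  have h2 := Finset.single_le_sum (f := fun j => ∑ k, ‖h j k‖ ^ 2) (fun _ _ => by positivity)
    (Finset.mem_univ j)
  have h3 : 0 ≤ μ ^ 2 * ∑ j, ‖g j‖ ^ 2 := by positivity
  have h4 : 0 ≤ (μ ^ 2) ^ 2 * ‖u‖ ^ 2 := by positivity
  unfold jetEnergy
  linarith

theorem mul_norm_grad_le_sqrt_jetEnergy (j : Fin (n + 1)) :
    μ * ‖g j‖ ≤ √(jetEnergy μ u g h) := by
  refine Real.le_sqrt_of_sq_le ?_
  have h1 := Finset.single_le_sum (f := fun j => ‖g j‖ ^ 2) (fun _ _ => by positivity)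
    (Finset.mem_univ j)
  have h2 : 0 ≤ ∑ j, ∑ k, ‖h j k‖ ^ 2 := by positivity
  have h4 : 0 ≤ (μ ^ 2) ^ 2 * ‖u‖ ^ 2 := by positivity
  have h5 := mul_le_mul_of_nonneg_left h1 (sq_nonneg μ)
  unfold jetEnergy
  rw [mul_pow]
  linarith

theorem mul_norm_le_sqrt_jetEnergy : μ ^ 2 * ‖u‖ ≤ √(jetEnergy μ u g h) := by
  refine Real.le_sqrt_of_sq_le ?_
  have h2 : 0 ≤ ∑ j, ∑ k, ‖h j k‖ ^ 2 := by positivity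
  have h3 : 0 ≤ μ ^ 2 * ∑ j, ‖g j‖ ^ 2 := by positivity
  unfold jetEnergy
  rw [mul_pow]
  linarith

theorem norm_hess_le_sqrt_tailEnergy (m : Fin n) (j : Fin (n + 1)) :
    ‖h m.succ j‖ ≤ √(tailEnergy μ u g h) := by
  refine Real.le_sqrt_of_sq_le ?_
  have h1 := Finset.single_le_sum (f := fun k => ‖h m.succ k‖ ^ 2) (fun _ _ => by positivity)
    (Finset.mem_univ j)
  have h2 := Finset.single_le_sum (f := fun m : Fin n => ∑ k, ‖h m.succ k‖ ^ 2)
    (fun _ _ => by positivity) (Finset.mem_univ m)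
  have h3 : 0 ≤ μ ^ 2 * ∑ j, ‖g j‖ ^ 2 := by positivity
  have h4 : 0 ≤ (μ ^ 2) ^ 2 * ‖u‖ ^ 2 := by positivity
  unfold tailEnergy
  linarith

theorem mul_norm_le_sqrt_tailEnergy : μ ^ 2 * ‖u‖ ≤ √(tailEnergy μ u g h) := by
  refine Real.le_sqrt_of_sq_le ?_
  have h2 : 0 ≤ ∑ m : Fin n, ∑ k, ‖h m.succ k‖ ^ 2 := by positivity
  have h3 : 0 ≤ μ ^ 2 * ∑ j, ‖g j‖ ^ 2 := by positivity
  unfold tailEnergy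
  rw [mul_pow]
  linarith

theorem jetEnergy_le (hsymm : ∀ j k, h j k = h k j) :
    jetEnergy μ u g h ≤ ‖h 0 0‖ ^ 2 + 2 * tailEnergy μ u g h := by
  have h1 : ∑ k : Fin n, ‖h 0 k.succ‖ ^ 2 ≤ ∑ m : Fin n, ∑ j, ‖h m.succ j‖ ^ 2 := by
    refine Finset.sum_le_sum fun k _ => ?_
    rw [hsymm]
    exact Finset.single_le_sum (f := fun j => ‖h k.succ j‖ ^ 2) (fun _ _ => by positivity)
      (Finset.mem_univ 0)
  have h3 : 0 ≤ μ ^ 2 * ∑ j, ‖g j‖ ^ 2 := by positivity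
  have h4 : 0 ≤ (μ ^ 2) ^ 2 * ‖u‖ ^ 2 := by positivity
  unfold jetEnergy tailEnergy
  rw [Fin.sum_univ_succ, Fin.sum_univ_succ]
  linarith

end Energy

section Abstract

variable {H : Type*} [NormedAddCommGroup H] [InnerProductSpace ℝ H]

/-- The standing hypotheses on the operator `∑ α^{jk} D_j D_k - μ² ρ`, with `D_j` the generator of
`T j`: the coefficients are self-adjoint and elliptic, `α^{00} = 1`, and all coefficients vary slowly along
the groups `T m`, `m ≠ 0`. The index `0` stands for the direction `x^1`. -/
structure AbstractCoeff {n : ℕ} (T : Fin (n + 1) → IsometryGroup H) (ε κ θ C : ℝ)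
    (α : Fin (n + 1) → Fin (n + 1) → H →L[ℝ] H) (ρ : H →L[ℝ] H) : Prop where
  symm : ∀ j k v w, inner ℝ (α j k v) w = inner ℝ (α j k w) v
  symm' : ∀ v w, inner ℝ (ρ v) w = inner ℝ (ρ w) v
  one : α 0 0 = 1
  norm_le : ∀ j k, ‖α j k‖ ≤ C
  norm_le' : ‖ρ‖ ≤ C
  slow : ∀ m : Fin n, ∀ j k, (T m.succ).SlowlyVarying ε κ (α j k)
  slow' : ∀ m : Fin n, (T m.succ).SlowlyVarying ε κ ρ
  coercive : ∀ v : Fin (n + 1) → H, θ * ∑ j, ‖v j‖ ^ 2 ≤ ∑ j, ∑ k, inner ℝ (α j k (v j)) (v k)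
  coercive' : ∀ v : H, θ * ‖v‖ ^ 2 ≤ inner ℝ (ρ v) v

/-- `g` and `h` are the first and second derivatives of `u` along the groups `T j`; the second derivatives
are symmetric. -/
structure IsJet {n : ℕ} (T : Fin (n + 1) → IsometryGroup H) (u : H) (g : Fin (n + 1) → H)
    (h : Fin (n + 1) → Fin (n + 1) → H) : Prop where
  grad : ∀ j, (T j).HasGenerator u (g j)
  hess : ∀ j k, (T k).HasGenerator (g j) (h j k)
  symm : ∀ j k, h j k = h k j

section Apriori

variable {n : ℕ} {T : Fin (n + 1) → IsometryGroup H} {ε κ θ C : ℝ}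
  {α : Fin (n + 1) → Fin (n + 1) → H →L[ℝ] H} {ρ : H →L[ℝ] H} {u : H} {g : Fin (n + 1) → H}
  {h : Fin (n + 1) → Fin (n + 1) → H}

/-- As `α 0 0 = 1`, the equation expresses `h 0 0` through the other terms. -/
theorem AbstractCoeff.norm_hess_zero_zero_le (hα : AbstractCoeff T ε κ θ C α ρ)
    (hu : IsJet T u g h) (μ : ℝ) :
    ‖h 0 0‖ ≤ ‖∑ j, ∑ k, α j k (h j k) - μ ^ 2 • ρ u‖
      + C * (n + 1) ^ 2 * √(tailEnergy μ u g h) := by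
  set G := ∑ j, ∑ k, α j k (h j k) - μ ^ 2 • ρ u with hG
  set P := √(tailEnergy μ u g h) with hP
  have hC : 0 ≤ C := (norm_nonneg _).trans hα.norm_le'
  have e : h 0 0 = G + (μ ^ 2 • ρ u - ∑ k : Fin n, α 0 k.succ (h 0 k.succ)
      - ∑ j : Fin n, ∑ k, α j.succ k (h j.succ k)) := by
    rw [hG, Fin.sum_univ_succ, Fin.sum_univ_succ, hα.one, one_apply_eq_self]
    abel
  have b1 : ‖μ ^ 2 • ρ u‖ ≤ C * P := by
    rw [norm_smul, Real.norm_of_nonneg (sq_nonneg μ)]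
    calc _ ≤ μ ^ 2 * (C * ‖u‖) := by
          gcongr
          exact (ρ.le_opNorm u).trans (by gcongr; exact hα.norm_le')
      _ = C * (μ ^ 2 * ‖u‖) := by ring
      _ ≤ C * P := by gcongr; exact mul_norm_le_sqrt_tailEnergy
  have b2 : ∀ j k (v : H), ‖v‖ ≤ P → ‖α j k v‖ ≤ C * P := fun j k v hv =>
    ((α j k).le_opNorm v).trans (by gcongr; exact hα.norm_le j k)
  have b3 : ‖∑ k : Fin n, α 0 k.succ (h 0 k.succ)‖ ≤ n * (C * P) := by
    refine (norm_sum_le_of_le _ fun k _ => b2 0 k.succ _ ?_).trans_eq (by simp)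
    rw [hu.symm]; exact norm_hess_le_sqrt_tailEnergy k 0
  have b4 : ‖∑ j : Fin n, ∑ k, α j.succ k (h j.succ k)‖ ≤ n * ((n + 1) * (C * P)) := by
    refine (norm_sum_le_of_le _ fun j _ => norm_sum_le_of_le _ fun k _ =>
      b2 j.succ k _ (norm_hess_le_sqrt_tailEnergy j k)).trans_eq (by simp)
  rw [e]
  refine (norm_add_le _ _).trans ?_
  have b5 := norm_sub_le (μ ^ 2 • ρ u - ∑ k : Fin n, α 0 k.succ (h 0 k.succ))
    (∑ j : Fin n, ∑ k, α j.succ k (h j.succ k))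
  have b6 := norm_sub_le (μ ^ 2 • ρ u) (∑ k : Fin n, α 0 k.succ (h 0 k.succ))
  have : C * (n + 1) ^ 2 * P = C * P + n * (C * P) + n * ((n + 1) * (C * P)) := by ring
  linarith

variable [CompleteSpace H]

/-- Lower bound for a leading term of the equation tested with `u_{x^m x^m}`, `m ≠ 0`. -/
theorem AbstractCoeff.inner_hess_hess_ge (hα : AbstractCoeff T ε κ θ C α ρ) (hε : 0 < ε)
    (hκ : 0 ≤ κ) (hT : ∀ i j s t, T i s * T j t = T j t * T i s) (hu : IsJet T u g h)
    {μ S : ℝ} (hμ : 0 < μ) (hh : ∀ j k, ‖h j k‖ ≤ S) (hg : ∀ j, μ * ‖g j‖ ≤ S)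
    (m : Fin n) (j k : Fin (n + 1)) :
    inner ℝ (α j k (h m.succ j)) (h m.succ k) - (4 * κ + 4 * C / (ε * μ)) * S ^ 2 ≤
      inner ℝ (α j k (h j k)) (h m.succ m.succ) := by
  have hS : 0 ≤ S := (norm_nonneg _).trans (hh 0 0)
  have hC : 0 ≤ C := (norm_nonneg _).trans hα.norm_le'
  have hg' : ∀ j, ‖g j‖ ≤ S / μ := fun j => by rw [le_div_iff₀' hμ]; exact hg j
  -- The derivative which is moved has to be one along which the coefficient varies slowly.
  have key : ∀ j k, ∀ A : H →L[ℝ] H, ‖A‖ ≤ C → (T k).SlowlyVarying ε κ A →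
      (T m.succ).SlowlyVarying ε κ A →
      inner ℝ (A (h m.succ j)) (h m.succ k) - (4 * κ + 4 * C / (ε * μ)) * S ^ 2 ≤
      inner ℝ (A (h j k)) (h m.succ m.succ) := by
    intro j k A hA hk hm
    have h1 := hk.abs_inner_sub_inner_le hm hε (hT _ _) (hu.hess j k)
      (hu.hess j m.succ) (hu.hess m.succ k) (hu.hess m.succ m.succ)
    have b : 2 * κ * (‖h j k‖ * ‖h m.succ m.succ‖ + ‖h j m.succ‖ * ‖h m.succ k‖)
        + 2 * ‖A‖ / ε * (‖g j‖ * (‖h m.succ m.succ‖ + ‖h m.succ k‖))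
        ≤ 2 * κ * (S * S + S * S) + 2 * C / ε * (S / μ * (S + S)) := by
      gcongr <;> first | exact hh _ _ | exact hg' _
    have e : 2 * κ * (S * S + S * S) + 2 * C / ε * (S / μ * (S + S))
        = (4 * κ + 4 * C / (ε * μ)) * S ^ 2 := by
      field_simp; ring
    have := (abs_le.1 (h1.trans (b.trans_eq e))).1
    rw [hu.symm j m.succ] at this
    linarith
  induction k using Fin.cases with
  | succ k => exact key j k.succ _ (hα.norm_le _ _) (hα.slow k _ _) (hα.slow m _ _)
  | zero =>
    induction j using Fin.cases with
    | zero =>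
      exact key 0 0 _ (hα.norm_le _ _)
        (by rw [hα.one]; exact IsometryGroup.slowlyVarying_one _ hκ) (hα.slow m _ _)
    | succ j =>
      have h1 := key 0 j.succ _ (hα.norm_le j.succ 0) (hα.slow j _ _) (hα.slow m _ _)
      rwa [hα.symm, hu.symm 0 j.succ] at h1

theorem abs_inner_hess_add_inner_grad_le (hε : 0 < ε) (hκ : 0 ≤ κ) (hu : IsJet T u g h)
    {μ S : ℝ} (hμ : 0 < μ) (hh : ∀ j k, ‖h j k‖ ≤ S) (hg : ∀ j, μ * ‖g j‖ ≤ S)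
    (hu0 : μ ^ 2 * ‖u‖ ≤ S) {A : H →L[ℝ] H} (hA : ‖A‖ ≤ C) {j k : Fin (n + 1)}
    (hs : (T k).SlowlyVarying ε κ A) :
    |μ ^ 2 * inner ℝ (A (h j k)) u + μ ^ 2 * inner ℝ (A (g j)) (g k)| ≤
      (4 * κ + 4 * C / (ε * μ)) * S ^ 2 := by
  have hS : 0 ≤ S := (norm_nonneg _).trans (hh 0 0)
  have hC : 0 ≤ C := (norm_nonneg _).trans hA
  have hg' : ∀ j, ‖g j‖ ≤ S / μ := fun j => by rw [le_div_iff₀' hμ]; exact hg j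
  have h1 := hs.abs_inner_add_inner_le hε (hu.hess j k) (hu.grad k)
  rw [← mul_add, abs_mul, abs_of_pos (by positivity : 0 < μ ^ 2)]
  calc _ ≤ μ ^ 2 * (κ * (‖h j k‖ * ‖u‖ + ‖g j‖ * ‖g k‖) + 2 * ‖A‖ / ε * (‖g j‖ * ‖u‖)) := by
        gcongr
    _ = κ * (‖h j k‖ * (μ ^ 2 * ‖u‖) + (μ * ‖g j‖) * (μ * ‖g k‖))
        + 2 * ‖A‖ / ε * (‖g j‖ * (μ ^ 2 * ‖u‖)) := by ring
    _ ≤ κ * (S * S + S * S) + 2 * C / ε * (S / μ * S) := by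
        gcongr <;> first | exact hh _ _ | exact hg' _ | exact hg _
    _ ≤ 2 * (κ * (S * S + S * S) + 2 * C / ε * (S / μ * S)) := by
        have : 0 ≤ κ * (S * S + S * S) + 2 * C / ε * (S / μ * S) := by positivity
        linarith
    _ = _ := by field_simp; ring

/-- Lower bound for a leading term of the equation tested with `-λ u`. -/
theorem AbstractCoeff.neg_inner_hess_ge (hα : AbstractCoeff T ε κ θ C α ρ) (hε : 0 < ε)
    (hκ : 0 ≤ κ) (hu : IsJet T u g h)
    {μ S : ℝ} (hμ : 0 < μ) (hh : ∀ j k, ‖h j k‖ ≤ S) (hg : ∀ j, μ * ‖g j‖ ≤ S)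
    (hu0 : μ ^ 2 * ‖u‖ ≤ S) (j k : Fin (n + 1)) :
    μ ^ 2 * inner ℝ (α j k (g j)) (g k) - (4 * κ + 4 * C / (ε * μ)) * S ^ 2 ≤
      -(μ ^ 2 * inner ℝ (α j k (h j k)) u) := by
  have key := fun (j k : Fin (n + 1)) (A : H →L[ℝ] H) (hA : ‖A‖ ≤ C)
      (hs : (T k).SlowlyVarying ε κ A) =>
    (abs_le.1 (abs_inner_hess_add_inner_grad_le hε hκ hu hμ hh hg hu0 hA (j := j) hs)).2
  induction k using Fin.cases with
  | succ k =>
    have := key j k.succ _ (hα.norm_le j k.succ) (hα.slow k _ _)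
    linarith
  | zero =>
    induction j using Fin.cases with
    | zero =>
      have := key 0 0 _ (hα.norm_le 0 0)
        (by rw [hα.one]; exact IsometryGroup.slowlyVarying_one _ hκ)
      linarith
    | succ j =>
      have := key 0 j.succ _ (hα.norm_le j.succ 0) (hα.slow j _ _)
      rw [hα.symm j.succ 0 (g 0), hu.symm 0 j.succ] at this
      linarith

/-- Lower bound for the zeroth order term of the equation tested with `u_{x^m x^m}`, `m ≠ 0`. -/
theorem AbstractCoeff.neg_inner_zeroth_ge (hα : AbstractCoeff T ε κ θ C α ρ) (hε : 0 < ε)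
    (hκ : 0 ≤ κ) (hθ : 0 ≤ θ) (hu : IsJet T u g h)
    {μ S : ℝ} (hμ : 0 < μ) (hh : ∀ j k, ‖h j k‖ ≤ S) (hg : ∀ j, μ * ‖g j‖ ≤ S)
    (hu0 : μ ^ 2 * ‖u‖ ≤ S) (m : Fin n) :
    - ((4 * κ + 4 * C / (ε * μ)) * S ^ 2) ≤
      -(μ ^ 2 * inner ℝ (ρ u) (h m.succ m.succ)) := by
  have h1 := (abs_le.1 (abs_inner_hess_add_inner_grad_le hε hκ hu hμ hh hg hu0 hα.norm_le'
    (j := m.succ) (hα.slow' m))).2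
  have h2 : 0 ≤ μ ^ 2 * inner ℝ (ρ (g m.succ)) (g m.succ) :=
    mul_nonneg (sq_nonneg _) (le_trans (by positivity) (hα.coercive' _))
  rw [hα.symm' u]
  linarith

/-- Testing the equation with `∑_{m ≠ 0} u_{x^m x^m} - λ u`. -/
theorem AbstractCoeff.tailEnergy_le (hα : AbstractCoeff T ε κ θ C α ρ) (hε : 0 < ε)
    (hκ : 0 ≤ κ) (hθ : 0 ≤ θ) (hT : ∀ i j s t, T i s * T j t = T j t * T i s) (hu : IsJet T u g h)
    {μ : ℝ} (hμ : 0 < μ) :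
    θ * tailEnergy μ u g h ≤
      (n + 1) * ‖∑ j, ∑ k, α j k (h j k) - μ ^ 2 • ρ u‖ * √(jetEnergy μ u g h)
      + 2 * (n + 1) ^ 3 * (4 * κ + 4 * C / (ε * μ)) * jetEnergy μ u g h := by
  set G := ∑ j, ∑ k, α j k (h j k) - μ ^ 2 • ρ u with hG
  set S := √(jetEnergy μ u g h) with hSdef
  set e := 4 * κ + 4 * C / (ε * μ) with he
  have hC : 0 ≤ C := (norm_nonneg _).trans hα.norm_le'
  have he0 : 0 ≤ e := by positivity
  have hS2 : jetEnergy μ u g h = S ^ 2 := (Real.sq_sqrt jetEnergy_nonneg).symm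
  have hh : ∀ j k, ‖h j k‖ ≤ S := norm_hess_le_sqrt_jetEnergy
  have hg : ∀ j, μ * ‖g j‖ ≤ S := mul_norm_grad_le_sqrt_jetEnergy
  have hu0 : μ ^ 2 * ‖u‖ ≤ S := mul_norm_le_sqrt_jetEnergy
  set X := ∑ m : Fin n, h m.succ m.succ - μ ^ 2 • u with hX
  have hXn : ‖X‖ ≤ (n + 1) * S := by
    refine (norm_sub_le _ _).trans ?_
    have h1 : ‖∑ m : Fin n, h m.succ m.succ‖ ≤ n * S := by
      refine (norm_sum_le_of_le _ fun m _ => hh m.succ m.succ).trans_eq ?_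
      simp
    rw [norm_smul, Real.norm_of_nonneg (sq_nonneg μ)]
    linarith
  have hup : inner ℝ G X ≤ (n + 1) * ‖G‖ * S := by
    refine (real_inner_le_norm _ _).trans ?_
    refine (mul_le_mul_of_nonneg_left hXn (norm_nonneg _)).trans_eq (by ring)
  have hexp : inner ℝ G X = ∑ m : Fin n, (∑ j, ∑ k, inner ℝ (α j k (h j k)) (h m.succ m.succ)
        + -(μ ^ 2 * inner ℝ (ρ u) (h m.succ m.succ)))
      + ∑ j, ∑ k, -(μ ^ 2 * inner ℝ (α j k (h j k)) u)
      + (μ ^ 2) ^ 2 * inner ℝ (ρ u) u := by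
    rw [hX, inner_sub_right, inner_sum]
    simp only [hG, inner_sub_left, sum_inner, inner_smul_left, inner_smul_right, conj_trivial,
      Finset.sum_neg_distrib, ← Finset.mul_sum, ← sub_eq_add_neg]
    ring
  have hcard : ∀ (c : ℝ) (f : Fin (n + 1) → Fin (n + 1) → ℝ),
      ∑ j, ∑ k, (f j k - c) = ∑ j, ∑ k, f j k - (n + 1) ^ 2 * c := fun c f => by
    simp only [Finset.sum_sub_distrib, Finset.sum_const, Finset.card_univ, Fintype.card_fin,
      nsmul_eq_mul]
    push_cast
    ring
  have l1 : ∀ m : Fin n, θ * ∑ j, ‖h m.succ j‖ ^ 2 - (n + 1) ^ 2 * (e * S ^ 2) - e * S ^ 2 ≤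
      ∑ j, ∑ k, inner ℝ (α j k (h j k)) (h m.succ m.succ)
        + -(μ ^ 2 * inner ℝ (ρ u) (h m.succ m.succ)) := fun m => by
    have h1 := Finset.sum_le_sum fun j (_ : j ∈ Finset.univ) => Finset.sum_le_sum
      fun k (_ : k ∈ Finset.univ) => hα.inner_hess_hess_ge hε hκ hT hu hμ hh hg m j k
    rw [hcard] at h1
    have h2 := hα.coercive (h m.succ)
    have h3 := hα.neg_inner_zeroth_ge hε hκ hθ hu hμ hh hg hu0 m
    linarith
  have l2 : θ * (μ ^ 2 * ∑ j, ‖g j‖ ^ 2) - (n + 1) ^ 2 * (e * S ^ 2) ≤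
      ∑ j, ∑ k, -(μ ^ 2 * inner ℝ (α j k (h j k)) u) := by
    have h1 := Finset.sum_le_sum fun j (_ : j ∈ Finset.univ) => Finset.sum_le_sum
      fun k (_ : k ∈ Finset.univ) => hα.neg_inner_hess_ge hε hκ hu hμ hh hg hu0 j k
    rw [hcard] at h1
    have h2 := mul_le_mul_of_nonneg_left (hα.coercive g) (sq_nonneg μ)
    simp only [← Finset.mul_sum] at h1
    linarith
  have l3 : θ * ((μ ^ 2) ^ 2 * ‖u‖ ^ 2) ≤ (μ ^ 2) ^ 2 * inner ℝ (ρ u) u := by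
    have := mul_le_mul_of_nonneg_left (hα.coercive' u) (sq_nonneg (μ ^ 2))
    linarith
  have l4 := Finset.sum_le_sum fun m (_ : m ∈ Finset.univ) => l1 m
  simp only [Finset.sum_sub_distrib, Finset.sum_const, Finset.card_univ, Fintype.card_fin,
      nsmul_eq_mul, ← Finset.mul_sum] at l4
  rw [hS2]
  have h5 : (n * (n + 1) ^ 2 + n + (n + 1) ^ 2) * (e * S ^ 2)
      ≤ (2 * (n + 1) ^ 3) * (e * S ^ 2) := by
    gcongr
    have : (0 : ℝ) ≤ n := Nat.cast_nonneg n
    nlinarith [mul_nonneg this this, mul_nonneg this (mul_nonneg this this)]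
  unfold tailEnergy
  rw [hexp] at hup
  linarith

/-- The a priori estimate for the abstract operator, under the smallness condition which allows the
commutator errors to be absorbed. -/
theorem AbstractCoeff.sqrt_jetEnergy_le (hα : AbstractCoeff T ε κ θ C α ρ) (hε : 0 < ε)
    (hκ : 0 ≤ κ) (hθ : 0 < θ) (hT : ∀ i j s t, T i s * T j t = T j t * T i s) (hu : IsJet T u g h)
    {μ B : ℝ} (hμ : 0 < μ) (hB : B = (2 * C ^ 2 * (n + 1) ^ 4 + 2) / θ)
    (hsmall : 4 * (n + 1) ^ 3 * B * (4 * κ + 4 * C / (ε * μ)) ≤ 1) :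
    √(jetEnergy μ u g h) ≤
      (2 * B * (n + 1) + 2) * ‖∑ j, ∑ k, α j k (h j k) - μ ^ 2 • ρ u‖ := by
  have h1 := hα.tailEnergy_le hε hκ hθ.le hT hu hμ
  have h2 := hα.norm_hess_zero_zero_le hu μ
  have h3 := jetEnergy_le (μ := μ) (u := u) (g := g) hu.symm
  have hP2 := Real.sq_sqrt (tailEnergy_nonneg (μ := μ) (u := u) (g := g) (h := h))
  have hS2 := Real.sq_sqrt (jetEnergy_nonneg (μ := μ) (u := u) (g := g) (h := h))
  have hB0 : 0 < B := by rw [hB]; positivity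
  have hG0 := norm_nonneg (∑ j, ∑ k, α j k (h j k) - μ ^ 2 • ρ u)
  generalize ‖∑ j, ∑ k, α j k (h j k) - μ ^ 2 • ρ u‖ = G at *
  have hC : 0 ≤ C := (norm_nonneg _).trans hα.norm_le'
  have hS0 := Real.sqrt_nonneg (jetEnergy μ u g h)
  set S := √(jetEnergy μ u g h)
  set P := √(tailEnergy μ u g h)
  set e := 4 * κ + 4 * C / (ε * μ)
  rw [← hP2] at h1 h3
  rw [← hS2] at h1 h3
  have h4 : ‖h 0 0‖ ^ 2 ≤ 2 * G ^ 2 + 2 * (C * (n + 1) ^ 2 * P) ^ 2 := by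
    have := pow_le_pow_left₀ (norm_nonneg _) h2 2
    nlinarith [sq_nonneg (G - C * (n + 1) ^ 2 * P)]
  have h5 : S ^ 2 ≤ 2 * G ^ 2 + B * (θ * P ^ 2) := by
    have : B * (θ * P ^ 2) = (2 * C ^ 2 * (n + 1) ^ 4 + 2) * P ^ 2 := by
      rw [hB]; field_simp
    rw [this]
    linarith
  have h6 := mul_le_mul_of_nonneg_left h1 hB0.le
  have h7 := mul_le_mul_of_nonneg_right hsmall (sq_nonneg S)
  have h8 : S ^ 2 ≤ 4 * G ^ 2 + 2 * B * (n + 1) * G * S := by linarith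
  by_contra hcon
  push Not at hcon
  have h9 : 0 ≤ 2 * B * (n + 1) * G := by positivity
  have h10 : 2 * G < S - 2 * B * (n + 1) * G := by linarith
  nlinarith

end Apriori

end Abstract

/-! ### Translations and multiplication operators on `L_2` -/

/-- Translation `u ↦ u(· + y)` on `L_2(ℝ^d)`. -/
noncomputable def translation {n : ℕ} (y : Rd n) : L2Rd n →L[ℝ] L2Rd n :=
  (Lp.compMeasurePreservingₗᵢ ℝ (· + y)
    (measurePreserving_add_right volume y)).toContinuousLinearMap

section

variable {n : ℕ}

theorem coeFn_translation (y : Rd n) (u : L2Rd n) :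
    translation y u =ᵐ[volume] fun x => u (x + y) :=
  Lp.coeFn_compMeasurePreserving u (measurePreserving_add_right volume y)

theorem norm_translation (y : Rd n) (u : L2Rd n) : ‖translation y u‖ = ‖u‖ :=
  Lp.norm_compMeasurePreserving u (measurePreserving_add_right volume y)

theorem translation_add_apply (y z : Rd n) (u : L2Rd n) :
    translation (y + z) u = translation y (translation z u) := by
  refine Lp.ext ?_
  filter_upwards [coeFn_translation (y + z) u, coeFn_translation y (translation z u),
    (measurePreserving_add_right volume y).quasiMeasurePreserving.ae (coeFn_translation z u)]
    with x h1 h2 h3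
  rw [h1, h2, h3, add_assoc]

theorem translation_comm (y z : Rd n) (u : L2Rd n) :
    translation y (translation z u) = translation z (translation y u) := by
  rw [← translation_add_apply, ← translation_add_apply, add_comm y z]

theorem translation_zero : translation (0 : Rd n) = 1 := by
  ext1 u
  refine Lp.ext ?_
  filter_upwards [coeFn_translation 0 u] with x h1
  rw [h1, add_zero]
  rfl

theorem tendsto_translation (e : Rd n) (u : L2Rd n) :
    Tendsto (fun s : ℝ => translation (s • e) u) (𝓝 0) (𝓝 u) := by
  have h : Continuous fun s : ℝ => translation (s • e) u := by
    let g : ℝ → C(Rd n, Rd n) := fun s => ⟨fun x => x + s • e, by fun_prop⟩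
    have hg : Continuous g := ContinuousMap.continuous_of_continuous_uncurry g
      (by simp only [Function.uncurry_def, g, ContinuousMap.coe_mk]; fun_prop)
    exact (continuous_const (y := u)).compMeasurePreservingLp hg
      (fun s => measurePreserving_add_right volume (s • e)) (by norm_num)
  simpa [translation_zero] using h.tendsto 0

/-- The group of translations in the direction of the `i`-th coordinate. -/
noncomputable def coordTranslation (n : ℕ) (i : Fin (n + 1)) : IsometryGroup (L2Rd n) where
  toFun s := translation (s • EuclideanSpace.single i 1)
  map_zero := by rw [zero_smul, translation_zero]
  map_add s t := by
    ext1 u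
    rw [add_smul, translation_add_apply]
    rfl
  norm_map s v := norm_translation _ v

theorem coordTranslation_apply (i : Fin (n + 1)) (s : ℝ) :
    coordTranslation n i s = translation (s • EuclideanSpace.single i 1) := rfl

theorem coordTranslation_commute (i j : Fin (n + 1)) (s t : ℝ) :
    coordTranslation n i s * coordTranslation n j t =
      coordTranslation n j t * coordTranslation n i s := by
  ext1 u
  simp only [coordTranslation_apply, mul_apply_eq_comp]
  exact translation_comm _ _ u

/-- Multiplication by a bounded measurable function, as an operator on `L_2(ℝ^d)`. -/
noncomputable def mulOp {γ : Rd n → ℝ} (hγ : MemLp γ ⊤ volume) : L2Rd n →L[ℝ] L2Rd n :=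
  (ContinuousLinearMap.mul ℝ ℝ).holderL volume ⊤ 2 2 hγ.toLp

theorem coeFn_mulOp {γ : Rd n → ℝ} (hγ : MemLp γ ⊤ volume) (u : L2Rd n) :
    mulOp hγ u =ᵐ[volume] fun x => γ x * u x := by
  have h1 := (ContinuousLinearMap.mul ℝ ℝ).coeFn_holder (r := 2) hγ.toLp u
  filter_upwards [h1, hγ.coeFn_toLp] with x h1 h2
  rw [h2] at h1
  exact h1

theorem norm_mulOp_sub_mulOp_le {γ γ' : Rd n → ℝ} (hγ : MemLp γ ⊤ volume)
    (hγ' : MemLp γ' ⊤ volume) {C : ℝ} (hC : 0 ≤ C) (h : ∀ᵐ x, |γ x - γ' x| ≤ C) :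
    ‖mulOp hγ - mulOp hγ'‖ ≤ C := by
  refine ContinuousLinearMap.opNorm_le_bound _ hC fun u => ?_
  refine Lp.norm_le_mul_norm_of_ae_le_mul ?_
  filter_upwards [h, Lp.coeFn_sub (mulOp hγ u) (mulOp hγ' u), coeFn_mulOp hγ u,
    coeFn_mulOp hγ' u] with x h1 h2 h3 h4
  rw [sub_apply, h2, Pi.sub_apply, h3, h4, ← sub_mul, norm_mul]
  exact mul_le_mul_of_nonneg_right h1 (norm_nonneg _)

theorem norm_mulOp_le {γ : Rd n → ℝ} (hγ : MemLp γ ⊤ volume) {C : ℝ} (hC : 0 ≤ C)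
    (h : ∀ᵐ x, |γ x| ≤ C) : ‖mulOp hγ‖ ≤ C := by
  refine ContinuousLinearMap.opNorm_le_bound _ hC fun u => ?_
  refine Lp.norm_le_mul_norm_of_ae_le_mul ?_
  filter_upwards [h, coeFn_mulOp hγ u] with x h1 h3
  rw [h3, norm_mul]
  exact mul_le_mul_of_nonneg_right h1 (norm_nonneg _)

theorem mulOp_one (h : MemLp (fun _ : Rd n => (1 : ℝ)) ⊤ volume) : mulOp h = 1 := by
  ext1 u
  refine Lp.ext ?_
  filter_upwards [coeFn_mulOp h u] with x h1
  rw [h1, one_mul]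
  rfl

theorem mulOp_symm {γ : Rd n → ℝ} (hγ : MemLp γ ⊤ volume) (v w : L2Rd n) :
    inner ℝ (mulOp hγ v) w = inner ℝ (mulOp hγ w) v := by
  simp only [L2.inner_def]
  refine integral_congr_ae ?_
  filter_upwards [coeFn_mulOp hγ v, coeFn_mulOp hγ w] with x h1 h2
  rw [h1, h2]
  simp only [RCLike.inner_apply, conj_trivial]
  ring

theorem inner_mulOp {γ : Rd n → ℝ} (hγ : MemLp γ ⊤ volume) (v w : L2Rd n) :
    Integrable (fun x => γ x * v x * w x) ∧
      inner ℝ (mulOp hγ v) w = ∫ x, γ x * v x * w x := by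
  have h : (fun x => inner ℝ (mulOp hγ v x) (w x)) =ᵐ[volume] fun x => γ x * v x * w x := by
    filter_upwards [coeFn_mulOp hγ v] with x h1
    rw [h1]
    simp only [RCLike.inner_apply, conj_trivial]
    ring
  exact ⟨(L2.integrable_inner (mulOp hγ v) w).congr h, by
    rw [L2.inner_def]; exact integral_congr_ae h⟩

theorem memLp_comp_add {γ : Rd n → ℝ} (hγ : MemLp γ ⊤ volume) (y : Rd n) :
    MemLp (fun x => γ (x + y)) ⊤ volume :=
  hγ.comp_measurePreserving (measurePreserving_add_right volume y)

theorem conj_mulOp {γ : Rd n → ℝ} (hγ : MemLp γ ⊤ volume) (i : Fin (n + 1)) (s : ℝ) :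
    (coordTranslation n i).conj s (mulOp hγ) =
      mulOp (memLp_comp_add hγ (s • EuclideanSpace.single i 1)) := by
  ext1 u
  rw [IsometryGroup.conj_apply, mul_apply_eq_comp, mul_apply_eq_comp]
  set y : Rd n := s • EuclideanSpace.single i 1 with hy
  set v := coordTranslation n i (-s) u with hv
  have e : coordTranslation n i s v = u := IsometryGroup.apply_neg_apply _ s u
  rw [← e, coordTranslation_apply]
  refine Lp.ext ?_
  filter_upwards [coeFn_translation y (mulOp hγ v), coeFn_translation y v,
    coeFn_mulOp (memLp_comp_add hγ y) (translation y v),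
    (measurePreserving_add_right volume y).quasiMeasurePreserving.ae (coeFn_mulOp hγ v)]
    with x h1 h2 h3 h4
  rw [h1, h3, h2, h4]

theorem slowlyVarying_mulOp {γ : Rd n → ℝ} (hγ : MemLp γ ⊤ volume) {w : ℝ → ℝ} {ε κ : ℝ}
    {m : Fin n}
    (hw0 : Tendsto w (𝓝[≥] 0) (𝓝 0)) (hwκ : ∀ r, 0 ≤ r → r ≤ ε → w r ≤ κ)
    (hw : ∀ x y : Rd n, x 0 = y 0 → |γ x - γ y| ≤ w (dist x y)) :
    (coordTranslation n m.succ).SlowlyVarying ε κ (mulOp hγ) := by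
  have key : ∀ s : ℝ, ‖(coordTranslation n m.succ).conj s (mulOp hγ) - mulOp hγ‖ ≤ w |s| := by
    intro s
    have h1 : ∀ x : Rd n, |γ (x + s • EuclideanSpace.single m.succ 1) - γ x| ≤ w |s| := by
      intro x
      have := hw (x + s • EuclideanSpace.single m.succ 1) x (by simp)
      simpa [dist_eq_norm, norm_smul] using this
    rw [conj_mulOp]
    exact norm_mulOp_sub_mulOp_le _ _ ((abs_nonneg _).trans (h1 0)) (ae_of_all _ h1)
  refine ⟨?_, fun s hs => (key s).trans (hwκ _ (abs_nonneg _) hs)⟩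
  rw [tendsto_iff_norm_sub_tendsto_zero]
  refine squeeze_zero (fun _ => norm_nonneg _) key (hw0.comp ?_)
  refine tendsto_nhdsWithin_iff.2 ⟨?_, Eventually.of_forall fun s => abs_nonneg s⟩
  simpa using (continuous_abs (G := ℝ)).tendsto 0

end

/-! ### Weak derivatives as generators of translations -/

section

variable {n : ℕ}

theorem inner_translation_eq_integral (y : Rd n) (u : L2Rd n) {ψ : L2Rd n} {φ : Rd n → ℝ}
    (hψ : ψ =ᵐ[volume] φ) : inner ℝ (translation y u) ψ = ∫ x, u x * φ (x - y) := by
  rw [L2.inner_def, ← integral_add_right_eq_self (fun x => u x * φ (x - y)) y]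
  refine integral_congr_ae ?_
  filter_upwards [coeFn_translation y u, hψ] with x h1 h2
  rw [h1, h2, add_sub_cancel_right]
  simp only [RCLike.inner_apply, conj_trivial]
  ring

theorem L2Rd.locallyIntegrable (u : L2Rd n) : LocallyIntegrable u volume :=
  (Lp.memLp u).locallyIntegrable (by norm_num)

/-- Differentiation under the integral sign for the pairing of `u ∈ L_2` with a translated test
function. -/
theorem hasDerivAt_integral_mul_comp_sub (u : L2Rd n) {φ : Rd n → ℝ} (hφ : ContDiff ℝ ∞ φ)
    (hc : HasCompactSupport φ) (e : Rd n) (s₀ : ℝ) :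
    HasDerivAt (fun s : ℝ => ∫ x, u x * φ (x - s • e))
      (∫ x, u x * -(fderiv ℝ φ (x - s₀ • e) e)) s₀ := by
  have hφ1 : Continuous (fderiv ℝ φ) := hφ.continuous_fderiv (by simp)
  obtain ⟨C, hC⟩ := (hc.fderiv (𝕜 := ℝ)).exists_bound_of_continuous hφ1
  set K : Set (Rd n) := (fun p : Rd n × ℝ => p.1 + p.2 • e) ''
    (tsupport φ ×ˢ Set.Icc (s₀ - 1) (s₀ + 1)) with hK
  have hKc : IsCompact K := (hc.isCompact.prod isCompact_Icc).image (by fun_prop)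
  have hint : ∀ s : ℝ, Integrable (fun x => u x * φ (x - s • e)) := fun s => by
    have h1 : HasCompactSupport fun x => φ (x - s • e) := by
      have := hc.comp_homeomorph (Homeomorph.subRight (s • e))
      exact this
    have := L2Rd.locallyIntegrable u |>.integrable_smul_left_of_hasCompactSupport
      (g := fun x => φ (x - s • e)) (by fun_prop) h1
    simpa [mul_comm] using this
  refine (hasDerivAt_integral_of_dominated_loc_of_deriv_le (μ := volume)
    (F := fun s x => u x * φ (x - s • e))
    (F' := fun s x => u x * -(fderiv ℝ φ (x - s • e) e))
    (bound := K.indicator fun x => |u x| * (C * ‖e‖))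
    (s := Metric.ball s₀ 1) (Metric.ball_mem_nhds s₀ one_pos) ?_ (hint s₀) ?_ ?_ ?_ ?_).2
  · exact Eventually.of_forall fun s => (hint s).aestronglyMeasurable
  · refine (Lp.aestronglyMeasurable u).mul (Continuous.aestronglyMeasurable ?_)
    fun_prop
  · refine ae_of_all _ fun x s hs => ?_
    by_cases hx : x ∈ K
    · rw [Set.indicator_of_mem hx, norm_mul, norm_neg]
      exact mul_le_mul_of_nonneg_left (((fderiv ℝ φ (x - s • e)).le_opNorm e).trans
        (mul_le_mul_of_nonneg_right (hC _) (norm_nonneg _))) (abs_nonneg _)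
    · have h1 : x - s • e ∉ tsupport φ := fun h => hx ⟨(x - s • e, s), ⟨h, by
        rw [Metric.mem_ball, Real.dist_eq, abs_lt] at hs
        constructor <;> linarith [hs.1, hs.2]⟩, by simp⟩
      have h2 : fderiv ℝ φ (x - s • e) = 0 := by
        by_contra h3
        exact h1 (support_fderiv_subset ℝ h3)
      rw [Set.indicator_of_notMem hx, h2]
      simp
  · rw [integrable_indicator_iff hKc.measurableSet]
    exact ((L2Rd.locallyIntegrable u).integrableOn_isCompact hKc).abs.mul_const _
  · refine ae_of_all _ fun x s _ => ?_
    have h1 : HasDerivAt (fun s : ℝ => x - s • e) (-e) s := by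
      simpa using ((hasDerivAt_id s).smul_const e).const_sub x
    have h2 := ((hφ.differentiable (by simp)) (x - s • e)).hasFDerivAt.comp_hasDerivAt s h1
    rw [map_neg] at h2
    exact h2.const_mul (u x)

theorem IsWeakPartial.hasDerivAt_inner {i : Fin (n + 1)} {u v : L2Rd n} (h : IsWeakPartial i u v)
    {ψ : L2Rd n} {φ : Rd n → ℝ} (hψ : ψ =ᵐ[volume] φ) (hφ : ContDiff ℝ ∞ φ)
    (hc : HasCompactSupport φ) (s : ℝ) :
    HasDerivAt (fun s : ℝ => inner ℝ (coordTranslation n i s u) ψ)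
      (inner ℝ (coordTranslation n i s v) ψ) s := by
  set e : Rd n := EuclideanSpace.single i 1
  simp only [coordTranslation_apply, inner_translation_eq_integral _ _ hψ]
  have h1 := hasDerivAt_integral_mul_comp_sub u hφ hc e s
  have h2 := h (fun x => φ (x - s • e)) (by fun_prop)
    (hc.comp_homeomorph (Homeomorph.subRight (s • e)))
  simp only [fderiv_comp_sub] at h2
  convert h1 using 1
  simp only [_root_.mul_neg, integral_neg]
  rw [h2, neg_neg]

/-- A weak partial derivative in `L_2` is the limit in `L_2` of the difference quotients. -/
theorem IsWeakPartial.hasGenerator {i : Fin (n + 1)} {u v : L2Rd n} (h : IsWeakPartial i u v) :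
    (coordTranslation n i).HasGenerator u v := by
  set T := coordTranslation n i with hT
  have key : ∀ η > 0, ∀ r > 0, (∀ s : ℝ, |s| < r → ‖T s v - v‖ ≤ η) →
      ∀ s : ℝ, |s| < r → ‖T s u - u - s • v‖ ≤ η * |s| := by
    intro η hη r hr hs s hsr
    have hdense : ∀ ψ : L2Rd n, |inner ℝ (T s u - u - s • v) ψ| ≤ η * |s| * ‖ψ‖ := by
      have hcl : IsClosed {ψ : L2Rd n | |inner ℝ (T s u - u - s • v) ψ| ≤ η * |s| * ‖ψ‖} :=
        isClosed_le (by fun_prop) (by fun_prop)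
      have hd := Lp.dense_hasCompactSupport_contDiff (F := ℝ) (μ := (volume : Measure (Rd n)))
        (p := 2) (by norm_num)
      intro ψ
      refine hcl.closure_subset_iff.2 ?_ (hd ψ)
      rintro ψ ⟨φ, hψ, hc, hφ⟩
      have hder : ∀ t : ℝ, HasDerivAt (fun t : ℝ => inner ℝ (T t u - t • v) ψ)
          (inner ℝ (T t v - v) ψ) t := fun t => by
        have h1 := (h.hasDerivAt_inner hψ hφ hc t).sub ((hasDerivAt_id t).mul_const (inner ℝ v ψ))
        simp only [inner_sub_left, inner_smul_left, conj_trivial]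
        rw [one_mul] at h1
        exact h1
      have h2 := (convex_uIcc (0 : ℝ) s).norm_image_sub_le_of_norm_hasDerivWithin_le
        (C := η * ‖ψ‖) (fun t _ => (hder t).hasDerivWithinAt) (fun t ht => by
          refine (norm_inner_le_norm _ _).trans
            (mul_le_mul_of_nonneg_right (hs t ?_) (norm_nonneg _))
          have := Set.abs_sub_left_of_mem_uIcc ht
          rw [sub_zero, sub_zero] at this
          exact this.trans_lt hsr) Set.left_mem_uIcc Set.right_mem_uIcc
      rw [← inner_sub_left] at h2
      have e0 : T s u - s • v - (T 0 u - (0 : ℝ) • v) = T s u - u - s • v := by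
        rw [T.map_zero, zero_smul, sub_zero, one_apply_eq_self]; abel
      rw [e0, sub_zero, Real.norm_eq_abs, Real.norm_eq_abs] at h2
      exact h2.trans_eq (by ring)
    have h3 := hdense (T s u - u - s • v)
    rw [real_inner_self_eq_norm_sq, abs_of_nonneg (sq_nonneg _), sq] at h3
    rcases (norm_nonneg (T s u - u - s • v)).eq_or_lt with h0 | h0
    · rw [← h0]; positivity
    · exact le_of_mul_le_mul_right h3 h0
  rw [IsometryGroup.HasGenerator, Metric.tendsto_nhdsWithin_nhds]
  intro η hη
  obtain ⟨r, hr, hs⟩ := Metric.tendsto_nhds_nhds.1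
    (tendsto_translation (EuclideanSpace.single i 1) v) (η / 2) (half_pos hη)
  refine ⟨r, hr, fun {s} hs0 hsr => ?_⟩
  have hs0 : s ≠ 0 := hs0
  rw [Real.dist_eq, sub_zero] at hsr
  have h1 := key (η / 2) (half_pos hη) r hr (fun s hs' => by
    have := hs (x := s) (by rwa [Real.dist_eq, sub_zero])
    rw [dist_eq_norm] at this
    exact this.le) s hsr
  rw [dist_eq_norm]
  have e : s⁻¹ • (T s u - u) - v = s⁻¹ • (T s u - u - s • v) := by
    rw [smul_sub s⁻¹ _ (s • v), inv_smul_smul₀ hs0]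
  rw [e, norm_smul, norm_inv, Real.norm_eq_abs]
  have hp : 0 < |s| := abs_pos.2 hs0
  refine lt_of_le_of_lt ?_ (half_lt_self hη)
  rw [inv_mul_le_iff₀ hp]
  exact h1.trans_eq (mul_comm _ _)

theorem IsWeakPartial.second_symm {i j : Fin (n + 1)} {u ui uj uij uji : L2Rd n}
    (hi : IsWeakPartial i u ui) (hj : IsWeakPartial j u uj) (hij : IsWeakPartial j ui uij)
    (hji : IsWeakPartial i uj uji) : uij = uji := by
  have key : ∀ {i j : Fin (n + 1)} {u ui uij : L2Rd n}, IsWeakPartial i u ui →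
      IsWeakPartial j ui uij → ∀ φ : Rd n → ℝ, ContDiff ℝ ∞ φ → HasCompactSupport φ →
      ∫ x, uij x * φ x = ∫ x, u x * fderiv ℝ (fderiv ℝ φ) x (EuclideanSpace.single i 1)
        (EuclideanSpace.single j 1) := by
    intro i j u ui uij hi hij φ hφ hc
    have hφ1 : ContDiff ℝ ∞ (fderiv ℝ φ) := hφ.fderiv_right (by simp)
    have h1 := hij φ hφ hc
    have h2 := hi (fun x => fderiv ℝ φ x (EuclideanSpace.single j 1)) (by fun_prop)
      (hc.fderiv_apply (𝕜 := ℝ) _)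
    have h3 : ∀ x, fderiv ℝ (fun x => fderiv ℝ φ x (EuclideanSpace.single j 1)) x
        (EuclideanSpace.single i 1) = fderiv ℝ (fderiv ℝ φ) x (EuclideanSpace.single i 1)
        (EuclideanSpace.single j 1) := fun x => by
      rw [fderiv_clm_apply (hφ1.differentiable (by simp) x) (by fun_prop)]
      simp
    simp only [h3] at h2
    rw [h2, h1, neg_neg]
  apply Lp.ext
  refine ae_eq_of_integral_contDiff_smul_eq (L2Rd.locallyIntegrable uij)
    (L2Rd.locallyIntegrable uji) ?_
  intro φ hφ hc
  have h1 := key hi hij φ hφ hc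
  have h2 := key hj hji φ hφ hc
  have hsymm : ∀ x, fderiv ℝ (fderiv ℝ φ) x (EuclideanSpace.single i 1)
      (EuclideanSpace.single j 1) = fderiv ℝ (fderiv ℝ φ) x (EuclideanSpace.single j 1)
      (EuclideanSpace.single i 1) := fun x =>
    ((contDiff_infty.1 hφ 2).contDiffAt.isSymmSndFDerivAt (by simp)) _ _
  simp only [hsymm] at h1
  simpa [mul_comm] using h1.trans h2.symm

theorem W22.isJet (u : W22 n) : IsJet (coordTranslation n) u.toL2 u.grad u.hess where
  grad j := (u.isWeakPartial_grad j).hasGenerator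
  hess j k := (u.isWeakPartial_hess j k).hasGenerator
  symm j k := (u.isWeakPartial_grad j).second_symm (u.isWeakPartial_grad k)
    (u.isWeakPartial_hess j k) (u.isWeakPartial_hess k j)

end

/-! ### The coefficients of the equation -/

section

variable {n : ℕ} {δ K : ℝ} {a : Rd n → Matrix (Fin (n + 1)) (Fin (n + 1)) ℝ}
  {b : Rd n → Fin (n + 1) → ℝ} {c : Rd n → ℝ}

theorem L2Rd.integrable_sq (v : L2Rd n) : Integrable fun x => v x ^ 2 := (Lp.memLp v).integrable_sq

theorem L2Rd.norm_sq_eq (v : L2Rd n) : ‖v‖ ^ 2 = ∫ x, v x ^ 2 := by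
  rw [← real_inner_self_eq_norm_sq, L2.inner_def]
  refine integral_congr_ae (ae_of_all _ fun x => ?_)
  simp [sq]

namespace CoeffAssumption

theorem le_a_zero_zero (h : CoeffAssumption δ K a b c) (x : Rd n) : δ ≤ a x 0 0 := by
  have := (h.elliptic x (Pi.single 0 1)).1
  simpa [Fin.sum_univ_succ, Pi.single_apply, Fin.succ_ne_zero] using this

theorem abs_a_le (h : CoeffAssumption δ K a b c) (hδ : 0 < δ) (x : Rd n) (j k : Fin (n + 1)) :
    |a x j k| ≤ δ⁻¹ := by
  have hexp : ∀ σ : ℝ, ∑ p, ∑ q, a x p q * (Pi.single j 1 + σ • Pi.single k 1 : Fin (n + 1) → ℝ) p *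
      (Pi.single j 1 + σ • Pi.single k 1 : Fin (n + 1) → ℝ) q
      = a x j j + 2 * σ * a x j k + σ ^ 2 * a x k k := fun σ => by
    simp only [Pi.add_apply, Pi.smul_apply, Pi.single_apply, smul_eq_mul, mul_add, add_mul,
      mul_ite, ite_mul, mul_one, mul_zero, zero_mul, Finset.sum_add_distrib, Finset.sum_ite_eq',
      Finset.mem_univ, if_true]
    rw [h.symm_a x k j]
    ring
  have hsq : ∀ σ : ℝ, ∑ p, (Pi.single j 1 + σ • Pi.single k 1 : Fin (n + 1) → ℝ) p ^ 2
      = 1 + 2 * σ * (if j = k then 1 else 0) + σ ^ 2 := fun σ => by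
    simp only [sq, Pi.add_apply, Pi.smul_apply, Pi.single_apply, smul_eq_mul, mul_add, add_mul,
      mul_ite, ite_mul, mul_one, mul_zero, zero_mul, Finset.sum_add_distrib, Finset.sum_ite_eq',
      Finset.mem_univ, if_true]
    rcases eq_or_ne j k with hjk | hjk
    · simp [hjk]; ring
    · simp [hjk, hjk.symm]
  have h1 := h.elliptic x (Pi.single j 1 + (1 : ℝ) • Pi.single k 1)
  have h2 := h.elliptic x (Pi.single j 1 + (-1 : ℝ) • Pi.single k 1)
  rw [hexp, hsq] at h1 h2
  have hδ' : 0 < δ⁻¹ := inv_pos.2 hδ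
  rw [abs_le]
  split_ifs at h1 h2 <;> constructor <;> nlinarith [h1.1, h1.2, h2.1, h2.2]

theorem memLp_of_bound {γ : Rd n → ℝ} (hγ : AEMeasurable γ volume) {C : ℝ}
    (h : ∀ x, |γ x| ≤ C) : MemLp γ ⊤ volume :=
  memLp_top_of_bound hγ.aestronglyMeasurable C (ae_of_all _ h)

theorem memLp_a (h : CoeffAssumption δ K a b c) (hδ : 0 < δ) (j k : Fin (n + 1)) :
    MemLp (fun x => a x j k) ⊤ volume :=
  memLp_of_bound (h.measurable_a j k) fun x => h.abs_a_le hδ x j k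

theorem memLp_b (h : CoeffAssumption δ K a b c) (j : Fin (n + 1)) :
    MemLp (fun x => b x j) ⊤ volume :=
  memLp_of_bound (h.measurable_b j) fun x => h.bound_b x j

theorem memLp_c (h : CoeffAssumption δ K a b c) : MemLp c ⊤ volume :=
  memLp_of_bound h.measurable_c h.bound_c

theorem abs_div_le (h : CoeffAssumption δ K a b c) (hδ : 0 < δ) (x : Rd n) (j k : Fin (n + 1)) :
    |a x j k / a x 0 0| ≤ δ⁻¹ ^ 2 := by
  have h0 := h.le_a_zero_zero x
  have h1 := h.abs_a_le hδ x j k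
  have h2 := hδ.trans_le h0
  rw [abs_div, abs_of_pos h2, div_eq_mul_inv, sq]
  gcongr

theorem abs_inv_le (h : CoeffAssumption δ K a b c) (hδ : 0 < δ) (x : Rd n) :
    |(a x 0 0)⁻¹| ≤ δ⁻¹ := by
  have h0 := h.le_a_zero_zero x
  rw [abs_inv, abs_of_pos (hδ.trans_le h0)]
  gcongr

theorem memLp_div (h : CoeffAssumption δ K a b c) (hδ : 0 < δ) (j k : Fin (n + 1)) :
    MemLp (fun x => a x j k / a x 0 0) ⊤ volume :=
  memLp_of_bound ((h.measurable_a j k).div (h.measurable_a 0 0)) fun x => h.abs_div_le hδ x j k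

theorem memLp_inv (h : CoeffAssumption δ K a b c) (hδ : 0 < δ) :
    MemLp (fun x => (a x 0 0)⁻¹) ⊤ volume :=
  memLp_of_bound (h.measurable_a 0 0).inv fun x => h.abs_inv_le hδ x

theorem abs_inv_sub_inv_le (h : CoeffAssumption δ K a b c) (hδ : 0 < δ) (hδ1 : δ < 1)
    {w : ℝ → ℝ}
    (hw : HasTailModulus w a) (x y : Rd n) (hxy : x 0 = y 0) :
    |(a x 0 0)⁻¹ - (a y 0 0)⁻¹| ≤ 2 * δ⁻¹ ^ 3 * w (dist x y) := by
  have hx := h.le_a_zero_zero x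
  have hy := h.le_a_zero_zero y
  have hxp := hδ.trans_le hx
  have hyp := hδ.trans_le hy
  have hw1 := hw y x hxy.symm 0 0
  rw [dist_comm] at hw1
  have hδ' : 1 ≤ δ⁻¹ := (one_le_inv₀ hδ).2 hδ1.le
  have hw2 := (abs_nonneg _).trans hw1
  rw [inv_sub_inv hxp.ne' hyp.ne', abs_div, abs_of_pos (mul_pos hxp hyp), div_eq_mul_inv, mul_inv]
  calc _ ≤ w (dist x y) * (δ⁻¹ * δ⁻¹) := by gcongr
    _ ≤ w (dist x y) * (2 * (δ⁻¹ * δ⁻¹ * δ⁻¹)) := by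
        have := mul_le_mul_of_nonneg_left hδ' (by positivity : 0 ≤ δ⁻¹ * δ⁻¹)
        refine mul_le_mul_of_nonneg_left ?_ hw2
        linarith [mul_pos (inv_pos.2 hδ) (inv_pos.2 hδ)]
    _ = _ := by ring

theorem abs_div_sub_div_le (h : CoeffAssumption δ K a b c) (hδ : 0 < δ) (hδ1 : δ < 1)
    {w : ℝ → ℝ}
    (hw : HasTailModulus w a) (x y : Rd n) (hxy : x 0 = y 0) (j k : Fin (n + 1)) :
    |a x j k / a x 0 0 - a y j k / a y 0 0| ≤ 2 * δ⁻¹ ^ 3 * w (dist x y) := by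
  have hx := h.le_a_zero_zero x
  have hy := h.le_a_zero_zero y
  have hxp := hδ.trans_le hx
  have hyp := hδ.trans_le hy
  have hw1 := hw x y hxy j k
  have hw2 := hw y x hxy.symm 0 0
  rw [dist_comm] at hw2
  have hδ' : 1 ≤ δ⁻¹ := (one_le_inv₀ hδ).2 hδ1.le
  have hw0 := (abs_nonneg _).trans hw1
  have e : a x j k / a x 0 0 - a y j k / a y 0 0 = (a x j k - a y j k) * (a x 0 0)⁻¹
      + a y j k * ((a y 0 0 - a x 0 0) * ((a x 0 0)⁻¹ * (a y 0 0)⁻¹)) := by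
    field_simp; ring
  rw [e]
  refine (abs_add_le _ _).trans ?_
  simp only [abs_mul, abs_inv, abs_of_pos hxp, abs_of_pos hyp]
  calc _ ≤ w (dist x y) * δ⁻¹ + δ⁻¹ * (w (dist x y) * (δ⁻¹ * δ⁻¹)) := by
        gcongr
        exact h.abs_a_le hδ _ _ _
    _ ≤ w (dist x y) * (δ⁻¹ * δ⁻¹ * δ⁻¹) + δ⁻¹ * (w (dist x y) * (δ⁻¹ * δ⁻¹)) := by
        gcongr
        nlinarith [mul_le_mul hδ' hδ' zero_le_one (zero_le_one.trans hδ')]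
    _ = _ := by ring

/-- The coefficients divided by `a^{11}` satisfy the hypotheses of the abstract estimate. -/
theorem abstractCoeff (h : CoeffAssumption δ K a b c) (hδ : 0 < δ) (hδ1 : δ < 1) {w : ℝ → ℝ}
    (hw : HasTailModulus w a) (hw0 : Tendsto w (𝓝[≥] 0) (𝓝 0)) {ε κ : ℝ}
    (hκ : ∀ r, 0 ≤ r → r ≤ ε → 2 * δ⁻¹ ^ 3 * w r ≤ κ) :
    AbstractCoeff (coordTranslation n) ε κ (δ ^ 2) (δ⁻¹ ^ 2) (fun j k => mulOp (h.memLp_div hδ j k))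
      (mulOp (h.memLp_inv hδ)) := by
  have hδ' : 1 ≤ δ⁻¹ := (one_le_inv₀ hδ).2 hδ1.le
  have hlim : Tendsto (fun r => 2 * δ⁻¹ ^ 3 * w r) (𝓝[≥] 0) (𝓝 0) := by
    have := hw0.const_mul (2 * δ⁻¹ ^ 3)
    rwa [mul_zero] at this
  refine ⟨fun j k v w => mulOp_symm _ v w, fun v w => mulOp_symm _ v w, ?_, fun j k => ?_, ?_,
    fun m j k => ?_, fun m => ?_, fun v => ?_, fun v => ?_⟩
  · have : (fun x => a x 0 0 / a x 0 0) = fun _ => 1 := by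
      ext x
      exact div_self (hδ.trans_le (h.le_a_zero_zero x)).ne'
    have h1 : MemLp (fun _ : Rd n => (1 : ℝ)) ⊤ volume := this ▸ h.memLp_div hδ 0 0
    rw [← mulOp_one h1]
    congr!
  · exact norm_mulOp_le _ (by positivity) (ae_of_all _ fun x => h.abs_div_le hδ x j k)
  · refine norm_mulOp_le _ (by positivity) (ae_of_all _ fun x => (h.abs_inv_le hδ x).trans ?_)
    nlinarith
  · exact slowlyVarying_mulOp _ hlim hκ fun x y hxy => h.abs_div_sub_div_le hδ hδ1 hw x y hxy j k
  · exact slowlyVarying_mulOp _ hlim hκ fun x y hxy => h.abs_inv_sub_inv_le hδ hδ1 hw x y hxy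
  · have h1 : ∀ j k, Integrable (fun x => a x j k / a x 0 0 * v j x * v k x) := fun j k =>
      (inner_mulOp (h.memLp_div hδ j k) (v j) (v k)).1
    simp only [fun j k => (inner_mulOp (h.memLp_div hδ j k) (v j) (v k)).2, L2Rd.norm_sq_eq]
    rw [← integral_finsetSum _ fun j _ => L2Rd.integrable_sq (v j), ← integral_const_mul]
    simp only [fun j => (integral_finsetSum Finset.univ fun k _ => h1 j k).symm]
    rw [← integral_finsetSum _ fun j _ => integrable_finsetSum _ fun k _ => h1 j k]
    refine integral_mono ((integrable_finsetSum _ fun j _ => L2Rd.integrable_sq (v j)).const_mul _)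
      (integrable_finsetSum _ fun j _ => integrable_finsetSum _ fun k _ => h1 j k) fun x => ?_
    have h2 := (h.elliptic x fun j => v j x).1
    have h0 := hδ.trans_le (h.le_a_zero_zero x)
    have h3 : δ ≤ (a x 0 0)⁻¹ := by
      rw [le_inv_comm₀ hδ h0]
      exact (le_abs_self _).trans (h.abs_a_le hδ x 0 0)
    simp only
    calc _ = δ * (δ * ∑ j, v j x ^ 2) := by ring
      _ ≤ (a x 0 0)⁻¹ * (δ * ∑ j, v j x ^ 2) := by gcongr
      _ ≤ (a x 0 0)⁻¹ * ∑ j, ∑ k, a x j k * v j x * v k x := by gcongr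
      _ = _ := by
        simp only [Finset.mul_sum]
        refine Finset.sum_congr rfl fun j _ => Finset.sum_congr rfl fun k _ => ?_
        ring
  · rw [(inner_mulOp (h.memLp_inv hδ) v v).2, L2Rd.norm_sq_eq, ← integral_const_mul]
    refine integral_mono ((L2Rd.integrable_sq v).const_mul _) (inner_mulOp (h.memLp_inv hδ) v v).1
      fun x => ?_
    have h0 := hδ.trans_le (h.le_a_zero_zero x)
    have h3 : δ ≤ (a x 0 0)⁻¹ := by
      rw [le_inv_comm₀ hδ h0]
      exact (le_abs_self _).trans (h.abs_a_le hδ x 0 0)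
    have h4 : δ ^ 2 ≤ (a x 0 0)⁻¹ := by nlinarith
    simp only
    rw [mul_assoc, ← sq]
    gcongr

/-- The operator `L` on `W_2^2(ℝ^d)` with values in `L_2(ℝ^d)`. -/
noncomputable def toL2 (h : CoeffAssumption δ K a b c) (hδ : 0 < δ) (u : W22 n) : L2Rd n :=
  ∑ j, ∑ k, mulOp (h.memLp_a hδ j k) (u.hess j k) + ∑ j, mulOp (h.memLp_b j) (u.grad j)
    + mulOp h.memLp_c u.toL2

theorem coeFn_toL2 (h : CoeffAssumption δ K a b c) (hδ : 0 < δ) (u : W22 n) :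
    h.toL2 hδ u =ᵐ[volume] ellipticOp a b c u := by
  have h1 : ∀ᵐ x, ∀ j k, mulOp (h.memLp_a hδ j k) (u.hess j k) x = a x j k * u.hess j k x := by
    simp only [ae_all_iff]
    exact fun j k => coeFn_mulOp _ _
  have h2 : ∀ᵐ x, ∀ j, mulOp (h.memLp_b j) (u.grad j) x = b x j * u.grad j x := by
    simp only [ae_all_iff]
    exact fun j => coeFn_mulOp _ _
  have h3 : ∀ᵐ x, ∀ j, (∑ k, mulOp (h.memLp_a hδ j k) (u.hess j k) : L2Rd n) x
      = ∑ k, mulOp (h.memLp_a hδ j k) (u.hess j k) x := by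
    rw [ae_all_iff]
    exact fun j => Lp.coeFn_fun_finsetSum _ _
  filter_upwards [h1, h2, h3, coeFn_mulOp h.memLp_c u.toL2,
    Lp.coeFn_fun_finsetSum Finset.univ fun j => ∑ k, mulOp (h.memLp_a hδ j k) (u.hess j k),
    Lp.coeFn_fun_finsetSum Finset.univ fun j => mulOp (h.memLp_b j) (u.grad j),
    Lp.coeFn_add (∑ j, ∑ k, mulOp (h.memLp_a hδ j k) (u.hess j k))
      (∑ j, mulOp (h.memLp_b j) (u.grad j)),
    Lp.coeFn_add (∑ j, ∑ k, mulOp (h.memLp_a hδ j k) (u.hess j k) +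
      ∑ j, mulOp (h.memLp_b j) (u.grad j)) (mulOp h.memLp_c u.toL2)] with x h1 h2 h3 h4 h5 h6 h7 h8
  rw [toL2, h8, Pi.add_apply, h7, Pi.add_apply, h5, h6, h4, ellipticOp]
  simp only [h1, h2, h3]

/-- Division of the leading part of `Lu - λu` by `a^{11}`. -/
theorem norm_normalized_le (h : CoeffAssumption δ K a b c) (hδ : 0 < δ) (u : W22 n) (lam : ℝ) :
    ‖∑ j, ∑ k, mulOp (h.memLp_div hδ j k) (u.hess j k) - lam • mulOp (h.memLp_inv hδ) u.toL2‖ ≤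
      δ⁻¹ * ‖∑ j, ∑ k, mulOp (h.memLp_a hδ j k) (u.hess j k) - lam • u.toL2‖ := by
  have e : ∑ j, ∑ k, mulOp (h.memLp_div hδ j k) (u.hess j k) - lam • mulOp (h.memLp_inv hδ) u.toL2
      = mulOp (h.memLp_inv hδ)
        (∑ j, ∑ k, mulOp (h.memLp_a hδ j k) (u.hess j k) - lam • u.toL2) := by
    simp only [map_sub, map_sum, map_smul]
    congr 1
    refine Finset.sum_congr rfl fun j _ => Finset.sum_congr rfl fun k _ => Lp.ext ?_
    filter_upwards [coeFn_mulOp (h.memLp_div hδ j k) (u.hess j k),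
      coeFn_mulOp (h.memLp_inv hδ) (mulOp (h.memLp_a hδ j k) (u.hess j k)),
      coeFn_mulOp (h.memLp_a hδ j k) (u.hess j k)] with x h1 h2 h3
    rw [h1, h2, h3]
    ring
  rw [e]
  refine ((mulOp (h.memLp_inv hδ)).le_opNorm _).trans ?_
  gcongr
  exact norm_mulOp_le _ (by positivity) (ae_of_all _ fun x => h.abs_inv_le hδ x)

end CoeffAssumption

end

/-! ### The a priori estimate -/

section

variable {n : ℕ} {δ K : ℝ}

/-- The lower order terms of `L` are small compared with `jetEnergy` for large `μ = √λ`. -/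
theorem CoeffAssumption.norm_leading_sub_le {a : Rd n → Matrix (Fin (n + 1)) (Fin (n + 1)) ℝ}
    {b : Rd n → Fin (n + 1) → ℝ} {c : Rd n → ℝ} (h : CoeffAssumption δ K a b c) (hδ : 0 < δ)
    (hK : 0 ≤ K) (u : W22 n) {μ : ℝ} (hμ : 1 ≤ μ) :
    ‖∑ j, ∑ k, mulOp (h.memLp_a hδ j k) (u.hess j k) - μ ^ 2 • u.toL2‖ ≤
      ‖h.toL2 hδ u - μ ^ 2 • u.toL2‖
        + K * (n + 2) / μ * √(jetEnergy μ u.toL2 u.grad u.hess) := by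
  have hμ0 : 0 < μ := one_pos.trans_le hμ
  set S := √(jetEnergy μ u.toL2 u.grad u.hess) with hS
  have hS0 : 0 ≤ S := Real.sqrt_nonneg _
  have e : ∑ j, ∑ k, mulOp (h.memLp_a hδ j k) (u.hess j k) - μ ^ 2 • u.toL2 =
      (h.toL2 hδ u - μ ^ 2 • u.toL2) - (∑ j, mulOp (h.memLp_b j) (u.grad j)
        + mulOp h.memLp_c u.toL2) := by
    rw [CoeffAssumption.toL2]; abel
  have hg : ∀ j, ‖u.grad j‖ ≤ S / μ := fun j => by
    rw [le_div_iff₀' hμ0]; exact mul_norm_grad_le_sqrt_jetEnergy j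
  have hu : ‖u.toL2‖ ≤ S / μ := by
    rw [le_div_iff₀' hμ0]
    refine le_trans ?_ (mul_norm_le_sqrt_jetEnergy (μ := μ) (g := u.grad) (h := u.hess))
    gcongr
    nlinarith
  have h1 : ‖∑ j, mulOp (h.memLp_b j) (u.grad j)‖ ≤ (n + 1) * (K * (S / μ)) := by
    refine (norm_sum_le_of_le _ fun j _ => ((mulOp (h.memLp_b j)).le_opNorm _).trans
      (mul_le_mul (norm_mulOp_le _ hK (ae_of_all _ fun x => h.bound_b x j)) (hg j)
        (norm_nonneg _) hK)).trans_eq (by simp)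
  have h2 : ‖mulOp h.memLp_c u.toL2‖ ≤ K * (S / μ) :=
    ((mulOp h.memLp_c).le_opNorm _).trans
      (mul_le_mul (norm_mulOp_le _ hK (ae_of_all _ h.bound_c)) hu (norm_nonneg _) hK)
  rw [e]
  refine (norm_sub_le _ _).trans (add_le_add_right ?_ _)
  refine (norm_add_le _ _).trans ((add_le_add h1 h2).trans_eq ?_)
  ring

theorem W22.weighted_norm_le (u : W22 n) {lam : ℝ} (hlam : 0 ≤ lam) :
    lam * ‖u.toL2‖ + √lam * u.gradNorm + u.hessNorm ≤
      3 * √(jetEnergy (√lam) u.toL2 u.grad u.hess) := by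
  have h1 := mul_norm_le_sqrt_jetEnergy (μ := √lam) (u := u.toL2) (g := u.grad) (h := u.hess)
  rw [Real.sq_sqrt hlam] at h1
  have h2 : √lam * u.gradNorm ≤ √(jetEnergy (√lam) u.toL2 u.grad u.hess) := by
    refine Real.le_sqrt_of_sq_le ?_
    rw [mul_pow, W22.gradNorm, Real.sq_sqrt (by positivity : 0 ≤ ∑ j, ‖u.grad j‖ ^ 2)]
    unfold jetEnergy
    have : 0 ≤ ∑ j, ∑ k, ‖u.hess j k‖ ^ 2 := by positivity
    have : 0 ≤ (√lam ^ 2) ^ 2 * ‖u.toL2‖ ^ 2 := by positivity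
    linarith
  have h3 : u.hessNorm ≤ √(jetEnergy (√lam) u.toL2 u.grad u.hess) := by
    refine Real.sqrt_le_sqrt ?_
    unfold jetEnergy
    have : 0 ≤ √lam ^ 2 * ∑ j, ‖u.grad j‖ ^ 2 := by positivity
    have : 0 ≤ (√lam ^ 2) ^ 2 * ‖u.toL2‖ ^ 2 := by positivity
    linarith
  linarith

/-- The a priori estimate for coefficients which are merely measurable in `x^1` and uniformly
continuous in `x'`, with `N` independent of the modulus of continuity. -/
theorem exists_apriori_estimate (n : ℕ) {δ K : ℝ} (hδ : 0 < δ) (hδ1 : δ < 1) (hK : 0 ≤ K) :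
    ∃ N : ℝ, 0 ≤ N ∧ ∀ w : ℝ → ℝ, Tendsto w (𝓝[≥] 0) (𝓝 0) → ∃ lam₀ : ℝ, 0 < lam₀ ∧
      ∀ (a : Rd n → Matrix (Fin (n + 1)) (Fin (n + 1)) ℝ)
        (b : Rd n → Fin (n + 1) → ℝ) (c : Rd n → ℝ)
        (h : CoeffAssumption δ K a b c), HasTailModulus w a → ∀ lam : ℝ, lam₀ ≤ lam →
        ∀ u : W22 n, lam * ‖u.toL2‖ + √lam * u.gradNorm + u.hessNorm ≤
          N * ‖h.toL2 hδ u - lam • u.toL2‖ := by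
  set C : ℝ := δ⁻¹ ^ 2 with hC
  set B : ℝ := (2 * C ^ 2 * (n + 1) ^ 4 + 2) / δ ^ 2 with hB
  set C₁ : ℝ := 2 * B * (n + 1) + 2 with hC₁
  have hC0 : 0 < C := by positivity
  have hB0 : 0 < B := by positivity
  have hC₁0 : 0 < C₁ := by positivity
  refine ⟨6 * (C₁ * δ⁻¹), by positivity, fun w hw => ?_⟩
  -- The oscillation `κ` and then `λ₀` are chosen so that the commutator errors are absorbed.
  set κ : ℝ := (32 * (n + 1) ^ 3 * B)⁻¹ with hκ
  have hκ0 : 0 < κ := by positivity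
  obtain ⟨ε, hε, hεw⟩ : ∃ ε > 0, ∀ r, 0 ≤ r → r ≤ ε → 2 * δ⁻¹ ^ 3 * w r ≤ κ := by
    have h1 := (hw.const_mul (2 * δ⁻¹ ^ 3)).eventually_le_const
      (show 2 * δ⁻¹ ^ 3 * 0 < κ by rw [mul_zero]; exact hκ0)
    obtain ⟨ε, hε, h2⟩ := Metric.mem_nhdsWithin_iff.1 h1
    refine ⟨ε / 2, half_pos hε, fun r h0 h1 => h2 ⟨?_, h0⟩⟩
    rw [Metric.mem_ball, Real.dist_eq, sub_zero, abs_of_nonneg h0]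
    linarith
  set μ₀ : ℝ := 1 + 32 * (n + 1) ^ 3 * B * C / ε + 2 * (C₁ * δ⁻¹ * (K * (n + 2))) with hμ₀
  have hp1 : 0 ≤ 32 * (n + 1) ^ 3 * B * C / ε := by positivity
  have hp2 : 0 ≤ 2 * (C₁ * δ⁻¹ * (K * (n + 2))) := by positivity
  have hμ₀1 : 1 ≤ μ₀ := by linarith
  refine ⟨μ₀ ^ 2, by positivity, fun a b c h hwa lam hlam u => ?_⟩
  have hlam0 : 0 ≤ lam := (sq_nonneg _).trans hlam
  set μ := √lam with hμ
  have hμμ : μ₀ ≤ μ := Real.le_sqrt_of_sq_le hlam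
  have hμ1 : 1 ≤ μ := hμ₀1.trans hμμ
  have hμ0 : 0 < μ := one_pos.trans_le hμ1
  have hlm : lam = μ ^ 2 := (Real.sq_sqrt hlam0).symm
  have hsmall : 4 * (n + 1) ^ 3 * B * (4 * κ + 4 * C / (ε * μ)) ≤ 1 := by
    have e1 : 4 * (n + 1) ^ 3 * B * (4 * κ) = 1 / 2 := by
      rw [hκ]; field_simp; norm_num
    have e2 : 4 * (n + 1) ^ 3 * B * (4 * C / (ε * μ))
        = (32 * (n + 1) ^ 3 * B * C / ε) / μ / 2 := by field_simp; ring
    have e3 : (32 * (n + 1) ^ 3 * B * C / ε) / μ ≤ 1 := by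
      rw [div_le_one hμ0]; linarith
    rw [mul_add, e1, e2]
    linarith
  have h1 := (h.abstractCoeff hδ hδ1 hwa hw hεw).sqrt_jetEnergy_le hε hκ0.le (by positivity)
    coordTranslation_commute u.isJet hμ0 hB hsmall
  have h2 := h.norm_normalized_le hδ u (μ ^ 2)
  have h3 := h.norm_leading_sub_le hδ hK u hμ1
  have h4 := u.weighted_norm_le hlam0
  rw [← hμ] at h4
  rw [hlm] at h4 ⊢
  set S := √(jetEnergy μ u.toL2 u.grad u.hess) with hS
  have hS0 : 0 ≤ S := Real.sqrt_nonneg _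
  set F := ‖h.toL2 hδ u - μ ^ 2 • u.toL2‖
  have h5 : S ≤ C₁ * (δ⁻¹ * (F + K * (n + 2) / μ * S)) :=
    h1.trans (mul_le_mul_of_nonneg_left
      (h2.trans (mul_le_mul_of_nonneg_left h3 (inv_pos.2 hδ).le)) hC₁0.le)
  have h6 : C₁ * (δ⁻¹ * (K * (n + 2) / μ * S)) ≤ S / 2 := by
    have e1 : C₁ * (δ⁻¹ * (K * (n + 2) / μ * S))
        = (2 * (C₁ * δ⁻¹ * (K * (n + 2)))) / μ * (S / 2) := by field_simp
    have e2 : (2 * (C₁ * δ⁻¹ * (K * (n + 2)))) / μ ≤ 1 := by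
      rw [div_le_one hμ0]; linarith
    rw [e1]
    exact mul_le_of_le_one_left (by positivity) e2
  have h7 : S ≤ 2 * (C₁ * δ⁻¹ * F) := by linarith
  linarith

end

/-! ### Solvability of `Δu - λu = f` for Schwartz functions -/

section

open SchwartzMap LineDeriv Laplacian

/-- The resolvent of the Laplacian is the Fourier multiplier `-(λ + 4π²|ξ|²)⁻¹`, written below as
`-λ⁻¹ (1 + |2π ξ / √λ|²)⁻¹`. -/
theorem SchwartzMap.exists_laplacian_sub_smul_eq {E : Type*} [NormedAddCommGroup E]
    [InnerProductSpace ℝ E] [FiniteDimensional ℝ E] [MeasurableSpace E] [BorelSpace E] {lam : ℝ}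
    (hlam : 0 < lam) (f : 𝓢(E, ℂ)) : ∃ u : 𝓢(E, ℂ), Δ u - lam • u = f := by
  set c : ℝ := 2 * Real.pi / √lam with hc
  have hsq : c ^ 2 = (2 * Real.pi) ^ 2 / lam := by
    rw [hc, div_pow, Real.sq_sqrt hlam.le]
  set m : E → ℝ := fun x => (1 + ‖c • x‖ ^ 2) ^ (-1 : ℝ) with hm
  have hmt : m.HasTemperateGrowth := by
    have h2 : (fun x : E => c • x).HasTemperateGrowth :=
      (c • ContinuousLinearMap.id ℝ E).hasTemperateGrowth
    exact (Function.hasTemperateGrowth_one_add_norm_sq_rpow E (-1)).comp h2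
  have hnt : (fun x : E => ‖x‖ ^ 2).HasTemperateGrowth := by fun_prop
  have hnm : ((fun x : E => ‖x‖ ^ 2) * m).HasTemperateGrowth := hnt.mul hmt
  refine ⟨-lam⁻¹ • fourierMultiplierCLM ℂ m f, ?_⟩
  rw [laplacian_eq_fourierMultiplierCLM, map_smul,
    fourierMultiplierCLM_fourierMultiplierCLM_apply hnt hmt]
  have e : (c ^ 2 • ((fun x : E => ‖x‖ ^ 2) * m) + m) = fun _ => (1 : ℝ) := by
    ext x
    simp only [Pi.add_apply, Pi.smul_apply, Pi.mul_apply, smul_eq_mul, hm, Real.rpow_neg_one,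
      norm_smul, mul_pow, Real.norm_eq_abs, sq_abs]
    have : 0 < 1 + c ^ 2 * ‖x‖ ^ 2 := by positivity
    field_simp
    ring
  have h1 : fourierMultiplierCLM ℂ (fun _ : E => (1 : ℝ)) f = f := by
    rw [fourierMultiplierCLM_const]; simp
  have hcm : (c ^ 2 • ((fun x : E => ‖x‖ ^ 2) * m)).HasTemperateGrowth := by
    have := (Function.HasTemperateGrowth.const (E := E) (c ^ 2)).mul hnm
    exact this
  have h3 : fourierMultiplierCLM ℂ (c ^ 2 • ((fun x : E => ‖x‖ ^ 2) * m) + m) f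
      = c ^ 2 • fourierMultiplierCLM ℂ ((fun x : E => ‖x‖ ^ 2) * m) f
        + fourierMultiplierCLM ℂ m f := by
    rw [fourierMultiplierCLM_apply, smulLeftCLM_add hcm hmt, smulLeftCLM_smul hnm]
    simp only [fourierMultiplierCLM_apply, _root_.add_apply, _root_.smul_apply,
      FourierTransform.fourierInv_add, FourierTransform.fourierInv_smul]
  rw [e, h1, hsq] at h3
  conv_rhs => rw [h3]
  rw [smul_smul, smul_smul, sub_eq_add_neg, ← neg_smul]
  congr 1
  · congr 1; field_simp
  · have : -(lam * -lam⁻¹) = 1 := by field_simp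
    rw [this, one_smul]

/-- The real-valued version: the real part of the complex solution. -/
theorem SchwartzMap.exists_sum_lineDeriv_sub_smul_eq {n : ℕ} {lam : ℝ} (hlam : 0 < lam)
    (f : 𝓢(Rd n, ℝ)) : ∃ u : 𝓢(Rd n, ℝ), ∑ j : Fin (n + 1),
      ∂_{(EuclideanSpace.single j 1 : Rd n)} (∂_{(EuclideanSpace.single j 1 : Rd n)} u)
        - lam • u = f := by
  obtain ⟨v, hv⟩ := exists_laplacian_sub_smul_eq hlam (f.postcompCLM Complex.ofRealCLM)
  refine ⟨v.postcompCLM Complex.reCLM, ?_⟩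
  have hd : ∀ (g : 𝓢(Rd n, ℂ)) (e : Rd n),
      ∂_{e} (g.postcompCLM Complex.reCLM) = (∂_{e} g).postcompCLM Complex.reCLM := by
    intro g e
    ext x
    rw [lineDerivOp_apply_eq_fderiv, postcompCLM_apply, lineDerivOp_apply_eq_fderiv]
    have h1 : ⇑(g.postcompCLM Complex.reCLM) = Complex.reCLM ∘ g := rfl
    rw [h1, fderiv_comp x (by fun_prop) g.differentiableAt, ContinuousLinearMap.fderiv]
    rfl
  rw [laplacian_eq_sum (EuclideanSpace.basisFun (Fin (n + 1)) ℝ)] at hv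
  simp only [EuclideanSpace.basisFun_apply] at hv
  simp only [hd]
  rw [← map_sum, ← map_smul, ← map_sub, hv]
  ext x
  simp

theorem SchwartzMap.isWeakPartial {n : ℕ} (u : 𝓢(Rd n, ℝ)) (i : Fin (n + 1)) :
    IsWeakPartial i (u.toLp 2) ((∂_{(EuclideanSpace.single i 1 : Rd n)} u).toLp 2) := by
  intro φ hφ hc
  have h := integral_mul_lineDerivOp_right_eq_neg_left (μ := volume) u (hc.toSchwartzMap hφ)
    (EuclideanSpace.single i 1)
  simp only [lineDerivOp_apply_eq_fderiv, HasCompactSupport.toSchwartzMap_toFun] at h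
  have h1 : ∫ x, u.toLp 2 volume x * fderiv ℝ φ x (EuclideanSpace.single i 1)
      = ∫ x, u x * fderiv ℝ φ x (EuclideanSpace.single i 1) := by
    refine integral_congr_ae ?_
    filter_upwards [u.coeFn_toLp 2 volume] with x hx
    rw [hx]
  have h2 : ∫ x, (∂_{(EuclideanSpace.single i 1 : Rd n)} u).toLp 2 volume x * φ x
      = ∫ x, fderiv ℝ u x (EuclideanSpace.single i 1) * φ x := by
    refine integral_congr_ae ?_
    filter_upwards [(∂_{(EuclideanSpace.single i 1 : Rd n)} u).coeFn_toLp 2 volume] with x hx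
    rw [hx]
    rfl
  rw [h1, h2]
  exact h

/-- A Schwartz function as an element of `W_2^2(ℝ^d)`. -/
noncomputable def SchwartzMap.toW22 {n : ℕ} (u : 𝓢(Rd n, ℝ)) : W22 n where
  toL2 := u.toLp 2
  grad j := (∂_{(EuclideanSpace.single j 1 : Rd n)} u).toLp 2
  hess j k := (∂_{(EuclideanSpace.single k 1 : Rd n)}
    (∂_{(EuclideanSpace.single j 1 : Rd n)} u)).toLp 2
  isWeakPartial_grad j := u.isWeakPartial j
  isWeakPartial_hess j k := (∂_{(EuclideanSpace.single j 1 : Rd n)} u).isWeakPartial k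

end

/-! ### The Sobolev space as a Banach space -/

section

variable {n : ℕ}

/-- The weak derivative relation is an equation between continuous linear functionals. -/
theorem isWeakPartial_iff_inner {i : Fin (n + 1)} {u v : L2Rd n} : IsWeakPartial i u v ↔
    ∀ ψ ψ' : L2Rd n, ∀ φ : Rd n → ℝ, ContDiff ℝ ∞ φ → HasCompactSupport φ → ψ =ᵐ[volume] φ →
      ψ' =ᵐ[volume] (fun x => fderiv ℝ φ x (EuclideanSpace.single i 1)) →
      inner ℝ u ψ' = -inner ℝ v ψ := by
  have key : ∀ (u ψ : L2Rd n) (φ : Rd n → ℝ), ψ =ᵐ[volume] φ →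
      inner ℝ u ψ = ∫ x, u x * φ x := fun u ψ φ h => by
    rw [L2.inner_def]
    refine integral_congr_ae ?_
    filter_upwards [h] with x hx
    rw [hx]
    simp [mul_comm]
  constructor
  · intro h ψ ψ' φ hφ hc h1 h2
    rw [key _ _ _ h1, key _ _ _ h2]
    exact h φ hφ hc
  · intro h φ hφ hc
    have m1 : MemLp φ 2 volume := hφ.continuous.memLp_of_hasCompactSupport hc
    have hd : Continuous fun x => fderiv ℝ φ x (EuclideanSpace.single i 1) :=
      (hφ.continuous_fderiv (by simp)).clm_apply continuous_const
    have m2 : MemLp (fun x => fderiv ℝ φ x (EuclideanSpace.single i 1)) 2 volume :=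
      hd.memLp_of_hasCompactSupport (hc.fderiv_apply (𝕜 := ℝ) _)
    have := h m1.toLp m2.toLp φ hφ hc m1.coeFn_toLp m2.coeFn_toLp
    rwa [key _ _ _ m1.coeFn_toLp, key _ _ _ m2.coeFn_toLp] at this

/-- `W_2^2(ℝ^d)` as the space of 2-jets `(u, u_x, u_xx)`, a closed subspace of a product of copies
of `L_2`. -/
def sobolevSubmodule (n : ℕ) : Submodule ℝ
    (L2Rd n × (Fin (n + 1) → L2Rd n) × (Fin (n + 1) → Fin (n + 1) → L2Rd n)) where
  carrier := {p | (∀ j, IsWeakPartial j p.1 (p.2.1 j)) ∧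
    ∀ j k, IsWeakPartial k (p.2.1 j) (p.2.2 j k)}
  zero_mem' := by
    simp only [isWeakPartial_iff_inner, Set.mem_ofPred_eq]
    exact ⟨fun j ψ ψ' φ _ _ _ _ => by simp, fun j k ψ ψ' φ _ _ _ _ => by simp⟩
  add_mem' {p q} hp hq := by
    simp only [isWeakPartial_iff_inner, Set.mem_ofPred_eq] at hp hq ⊢
    refine ⟨fun j ψ ψ' φ h1 h2 h3 h4 => ?_, fun j k ψ ψ' φ h1 h2 h3 h4 => ?_⟩
    · have e1 := hp.1 j ψ ψ' φ h1 h2 h3 h4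
      have e2 := hq.1 j ψ ψ' φ h1 h2 h3 h4
      simp only [Prod.fst_add, Prod.snd_add, Pi.add_apply, inner_add_left, e1, e2]
      ring
    · have e1 := hp.2 j k ψ ψ' φ h1 h2 h3 h4
      have e2 := hq.2 j k ψ ψ' φ h1 h2 h3 h4
      simp only [Prod.snd_add, Prod.fst_add, Pi.add_apply, inner_add_left, e1, e2]
      ring
  smul_mem' c p hp := by
    simp only [isWeakPartial_iff_inner, Set.mem_ofPred_eq] at hp ⊢
    refine ⟨fun j ψ ψ' φ h1 h2 h3 h4 => ?_, fun j k ψ ψ' φ h1 h2 h3 h4 => ?_⟩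
    · have e1 := hp.1 j ψ ψ' φ h1 h2 h3 h4
      simp only [Prod.smul_fst, Prod.smul_snd, Pi.smul_apply, inner_smul_left, conj_trivial, e1]
      ring
    · have e1 := hp.2 j k ψ ψ' φ h1 h2 h3 h4
      simp only [Prod.smul_fst, Prod.smul_snd, Pi.smul_apply, inner_smul_left, conj_trivial, e1]
      ring

theorem isClosed_sobolevSubmodule (n : ℕ) : IsClosed (sobolevSubmodule n : Set
    (L2Rd n × (Fin (n + 1) → L2Rd n) × (Fin (n + 1) → Fin (n + 1) → L2Rd n))) := by
  have h : (sobolevSubmodule n : Set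
    (L2Rd n × (Fin (n + 1) → L2Rd n) × (Fin (n + 1) → Fin (n + 1) → L2Rd n))) =
    {p | (∀ j, IsWeakPartial j p.1 (p.2.1 j)) ∧ ∀ j k, IsWeakPartial k (p.2.1 j) (p.2.2 j k)} := rfl
  rw [h]
  simp only [isWeakPartial_iff_inner, Set.ofPred_and, Set.ofPred_forall]
  refine IsClosed.inter ?_ ?_
  · refine isClosed_iInter fun j => isClosed_iInter fun ψ => isClosed_iInter fun ψ' =>
      isClosed_iInter fun φ => isClosed_iInter fun _ => isClosed_iInter fun _ =>
      isClosed_iInter fun _ => isClosed_iInter fun _ => isClosed_eq (by fun_prop) (by fun_prop)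
  · refine isClosed_iInter fun j => isClosed_iInter fun k => isClosed_iInter fun ψ =>
      isClosed_iInter fun ψ' => isClosed_iInter fun φ => isClosed_iInter fun _ =>
      isClosed_iInter fun _ => isClosed_iInter fun _ => isClosed_iInter fun _ =>
      isClosed_eq (by fun_prop) (by fun_prop)

instance (n : ℕ) : CompleteSpace (sobolevSubmodule n) :=
  (isClosed_sobolevSubmodule n).completeSpace_coe

/-- The element of `W_2^2(ℝ^d)` with a given 2-jet. -/
def W22.ofSobolev (p : sobolevSubmodule n) : W22 n where
  toL2 := p.1.1
  grad := p.1.2.1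
  hess := p.1.2.2
  isWeakPartial_grad := p.2.1
  isWeakPartial_hess := p.2.2

/-- The 2-jet of an element of `W_2^2(ℝ^d)`. -/
def W22.toSobolev (u : W22 n) : sobolevSubmodule n :=
  ⟨(u.toL2, u.grad, u.hess), u.isWeakPartial_grad, u.isWeakPartial_hess⟩

end

/-! ### The method of continuity -/

section

variable {V H : Type*} [NormedAddCommGroup V] [NormedSpace ℝ V] [CompleteSpace V]
  [NormedAddCommGroup H] [NormedSpace ℝ H] [CompleteSpace H]

/-- Perturbation of a surjective operator which is bounded below; the admissible size of the
perturbation depends only on the lower bound. -/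
theorem ContinuousLinearMap.surjective_of_norm_sub_lt {A A' : V →L[ℝ] H} {C : ℝ} (hC : 0 ≤ C)
    (hA : ∀ v, ‖v‖ ≤ C * ‖A v‖) (hs : Function.Surjective A) (h : C * ‖A' - A‖ < 1) :
    Function.Surjective A' := by
  have hinj : A.ker = ⊥ := by
    rw [LinearMap.ker_eq_bot']
    intro v hv
    have := hA v
    rw [show A v = 0 from hv, norm_zero, mul_zero] at this
    exact norm_le_zero_iff.1 this
  let e := ContinuousLinearEquiv.ofBijective A hinj (LinearMap.range_eq_top.2 hs)
  have he : ∀ v, e v = A v := fun v => rfl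
  set R : H →L[ℝ] H := (A' - A).comp (e.symm : H →L[ℝ] V) with hR
  have hRn : ‖R‖ < 1 := by
    refine lt_of_le_of_lt (ContinuousLinearMap.opNorm_le_bound _ (by positivity) fun f => ?_) h
    have h1 := hA (e.symm f)
    rw [← he, e.apply_symm_apply] at h1
    calc ‖R f‖ ≤ ‖A' - A‖ * ‖e.symm f‖ := (A' - A).le_opNorm _
      _ ≤ ‖A' - A‖ * (C * ‖f‖) := by gcongr
      _ = _ := by ring
  obtain ⟨Q, hQ⟩ : ∃ Q : H →L[ℝ] H, (1 + R) * Q = 1 := by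
    have : IsUnit (1 - (-R)) := isUnit_one_sub_of_norm_lt_one (by rwa [norm_neg])
    rw [sub_neg_eq_add] at this
    exact this.exists_right_inv
  intro f
  refine ⟨e.symm (Q f), ?_⟩
  have h1 : (1 + R) (Q f) = f := congrArg (fun T : H →L[ℝ] H => T f) hQ
  have h2 : A (e.symm (Q f)) = Q f := by rw [← he, e.apply_symm_apply]
  calc A' (e.symm (Q f)) = A (e.symm (Q f)) + (A' - A) (e.symm (Q f)) := by
        rw [_root_.sub_apply]; abel
    _ = f := by rw [h2]; exact h1

/-- The method of continuity: under a uniform lower bound on the segment from `A₀` to `A₁`, the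
parameters with surjective operator form an open and closed set. -/
theorem ContinuousLinearMap.surjective_of_continuity {A₀ A₁ : V →L[ℝ] H} {C : ℝ} (hC : 0 ≤ C)
    (hA : ∀ t ∈ Set.Icc (0 : ℝ) 1, ∀ v, ‖v‖ ≤ C * ‖(A₀ + t • (A₁ - A₀)) v‖)
    (hs : Function.Surjective A₀) : Function.Surjective A₁ := by
  set r : ℝ := (C * ‖A₁ - A₀‖ + 1)⁻¹ with hr
  have hr0 : 0 < r := by positivity
  let S : Set (Set.Icc (0 : ℝ) 1) := {t | Function.Surjective (A₀ + (t : ℝ) • (A₁ - A₀))}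
  have key : ∀ s t : Set.Icc (0 : ℝ) 1, dist t s < r → s ∈ S → t ∈ S := by
    intro s t hst hsS
    refine ContinuousLinearMap.surjective_of_norm_sub_lt hC (hA s s.2) hsS ?_
    rw [add_sub_add_left_eq_sub, ← sub_smul, norm_smul]
    have h1 : ‖(t : ℝ) - s‖ < r := by rwa [← dist_eq_norm]
    calc C * (‖(t : ℝ) - s‖ * ‖A₁ - A₀‖) = ‖(t : ℝ) - s‖ * (C * ‖A₁ - A₀‖) := by ring
      _ ≤ ‖(t : ℝ) - s‖ * (C * ‖A₁ - A₀‖ + 1) := by gcongr; linarith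
      _ < r * (C * ‖A₁ - A₀‖ + 1) := by gcongr
      _ = 1 := inv_mul_cancel₀ (by positivity)
  have hopen : IsOpen S := Metric.isOpen_iff.2 fun s hs => ⟨r, hr0, fun t ht => key s t ht hs⟩
  have hclosed : IsClosed S := ⟨Metric.isOpen_iff.2 fun s hs => ⟨r, hr0, fun t ht htS =>
    hs (key t s (by rw [dist_comm]; exact ht) htS)⟩⟩
  have hne : S.Nonempty := ⟨0, by simpa [S] using hs⟩
  have hu : S = Set.univ := IsClopen.eq_univ ⟨hclosed, hopen⟩ hne
  have h1 : (1 : Set.Icc (0 : ℝ) 1) ∈ S := hu ▸ Set.mem_univ _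
  simpa [S] using h1

end

/-! ### Solvability of the elliptic equation -/

section

variable {n : ℕ} {δ K : ℝ} {a : Rd n → Matrix (Fin (n + 1)) (Fin (n + 1)) ℝ}
  {b : Rd n → Fin (n + 1) → ℝ} {c : Rd n → ℝ}

/-- `L - λ` as a bounded operator from `W_2^2(ℝ^d)` to `L_2(ℝ^d)`. -/
noncomputable def CoeffAssumption.toCLM (h : CoeffAssumption δ K a b c) (hδ : 0 < δ) (lam : ℝ) :
    sobolevSubmodule n →L[ℝ] L2Rd n where
  toFun p := h.toL2 hδ (W22.ofSobolev p) - lam • p.1.1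
  map_add' p q := by
    simp only [toL2, W22.ofSobolev, Submodule.coe_add, Prod.fst_add, Prod.snd_add,
      Pi.add_apply, map_add, Finset.sum_add_distrib, smul_add]
    abel
  map_smul' r p := by
    simp only [toL2, W22.ofSobolev, Submodule.coe_smul, Prod.smul_fst, Prod.smul_snd,
      Pi.smul_apply, map_smul, ← Finset.smul_sum, RingHom.id_apply, smul_sub, smul_add,
      smul_comm lam r]
  cont := by
    simp only [toL2, W22.ofSobolev]
    fun_prop

theorem CoeffAssumption.coeFn_toL2_sub (h : CoeffAssumption δ K a b c) (hδ : 0 < δ) (lam : ℝ)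
    (u : W22 n) : (h.toL2 hδ u - lam • u.toL2 : L2Rd n) =ᵐ[volume]
      fun x => ellipticOp a b c u x - lam * u.toL2 x := by
  filter_upwards [Lp.coeFn_sub (h.toL2 hδ u) (lam • u.toL2), Lp.coeFn_smul lam u.toL2,
    h.coeFn_toL2 hδ u] with x h1 h2 h3
  rw [h1, Pi.sub_apply, h2, h3, Pi.smul_apply, smul_eq_mul]

/-- The coefficients of the Laplacian. -/
theorem coeffAssumption_laplacian (n : ℕ) (hδ : 0 < δ) (hδ1 : δ < 1) (hK : 0 ≤ K) :
    CoeffAssumption (n := n) δ K (fun _ => 1) (fun _ _ => 0) (fun _ => 0) where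
  measurable_a j k := aemeasurable_const
  measurable_b j := aemeasurable_const
  measurable_c := aemeasurable_const
  symm_a x j k := by simp [Matrix.one_apply, eq_comm]
  bound_b x j := by simpa using hK
  bound_c x := by simpa using hK
  elliptic x θ := by
    have e : ∑ j, ∑ k, (1 : Matrix (Fin (n + 1)) (Fin (n + 1)) ℝ) j k * θ j * θ k
        = ∑ j, θ j ^ 2 := by
      simp [Matrix.one_apply, sq]
    rw [e]
    have h0 : 0 ≤ ∑ j, θ j ^ 2 := by positivity
    exact ⟨mul_le_of_le_one_left h0 hδ1.le, le_mul_of_one_le_left h0 ((one_le_inv₀ hδ).2 hδ1.le)⟩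

/-- Coefficients on the segment joining `L` to the Laplacian. -/
theorem CoeffAssumption.segment (h : CoeffAssumption δ K a b c) (hδ : 0 < δ) (hδ1 : δ < 1)
    (hK : 0 ≤ K) {t : ℝ} (ht : t ∈ Set.Icc (0 : ℝ) 1) :
    CoeffAssumption δ K (fun x => (1 - t) • 1 + t • a x) (fun x j => t * b x j)
      (fun x => t * c x) where
  measurable_a j k := by
    simp only [Matrix.add_apply, Matrix.smul_apply]
    exact aemeasurable_const.add ((h.measurable_a j k).const_smul t)
  measurable_b j := (h.measurable_b j).const_mul t
  measurable_c := h.measurable_c.const_mul t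
  symm_a x j k := by
    simp only [Matrix.add_apply, Matrix.smul_apply, h.symm_a x j k, Matrix.one_apply, eq_comm]
  bound_b x j := by
    rw [abs_mul, abs_of_nonneg ht.1]
    exact (mul_le_of_le_one_left (abs_nonneg _) ht.2).trans (h.bound_b x j)
  bound_c x := by
    rw [abs_mul, abs_of_nonneg ht.1]
    exact (mul_le_of_le_one_left (abs_nonneg _) ht.2).trans (h.bound_c x)
  elliptic x θ := by
    have h1 := (coeffAssumption_laplacian n hδ hδ1 hK).elliptic x θ
    have h2 := h.elliptic x θ
    have e : ∑ j, ∑ k, ((1 - t) • 1 + t • a x : Matrix (Fin (n + 1)) (Fin (n + 1)) ℝ) j k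
        * θ j * θ k = (1 - t) * ∑ j, ∑ k, (1 : Matrix (Fin (n + 1)) (Fin (n + 1)) ℝ) j k * θ j * θ k
          + t * ∑ j, ∑ k, a x j k * θ j * θ k := by
      simp only [Finset.mul_sum, ← Finset.sum_add_distrib, Matrix.add_apply, Matrix.smul_apply,
        smul_eq_mul]
      refine Finset.sum_congr rfl fun j _ => Finset.sum_congr rfl fun k _ => ?_
      ring
    rw [e]
    have ht1 : 0 ≤ 1 - t := by linarith [ht.2]
    have l1 := mul_le_mul_of_nonneg_left h1.1 ht1
    have l2 := mul_le_mul_of_nonneg_left h1.2 ht1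
    have l3 := mul_le_mul_of_nonneg_left h2.1 ht.1
    have l4 := mul_le_mul_of_nonneg_left h2.2 ht.1
    constructor <;> linarith

theorem HasTailModulus.segment {w : ℝ → ℝ} (h : HasTailModulus w a) {t : ℝ}
    (ht : t ∈ Set.Icc (0 : ℝ) 1) :
    HasTailModulus w (fun x => (1 - t) • (1 : Matrix (Fin (n + 1)) (Fin (n + 1)) ℝ) + t • a x) := by
  intro x y hxy j k
  simp only [Matrix.add_apply, Matrix.smul_apply, smul_eq_mul]
  rw [add_sub_add_left_eq_sub, ← mul_sub, abs_mul, abs_of_nonneg ht.1]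
  exact (mul_le_of_le_one_left (abs_nonneg _) ht.2).trans (h x y hxy j k)

theorem CoeffAssumption.toCLM_segment (h : CoeffAssumption δ K a b c) (hδ : 0 < δ) (hδ1 : δ < 1)
    (hK : 0 ≤ K) {t : ℝ} (ht : t ∈ Set.Icc (0 : ℝ) 1) (lam : ℝ) :
    (h.segment hδ hδ1 hK ht).toCLM hδ lam = (coeffAssumption_laplacian n hδ hδ1 hK).toCLM hδ lam
      + t • (h.toCLM hδ lam - (coeffAssumption_laplacian n hδ hδ1 hK).toCLM hδ lam) := by
  ext1 p
  rw [_root_.add_apply, _root_.smul_apply, _root_.sub_apply]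
  set h0 := coeffAssumption_laplacian n hδ hδ1 hK
  refine Lp.ext ?_
  filter_upwards [(h.segment hδ hδ1 hK ht).coeFn_toL2_sub hδ lam (W22.ofSobolev p),
    h0.coeFn_toL2_sub hδ lam (W22.ofSobolev p), h.coeFn_toL2_sub hδ lam (W22.ofSobolev p),
    Lp.coeFn_add (h0.toCLM hδ lam p) (t • (h.toCLM hδ lam p - h0.toCLM hδ lam p)),
    Lp.coeFn_smul t (h.toCLM hδ lam p - h0.toCLM hδ lam p),
    Lp.coeFn_sub (h.toCLM hδ lam p) (h0.toCLM hδ lam p)] with x h1 h2 h3 h4 h5 h6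
  rw [h4, Pi.add_apply, h5, Pi.smul_apply, h6, Pi.sub_apply]
  refine h1.trans ?_
  have h2' : h0.toCLM hδ lam p x = _ := h2
  have h3' : h.toCLM hδ lam p x = _ := h3
  rw [h2', h3']
  simp only [ellipticOp, Matrix.add_apply, Matrix.smul_apply, smul_eq_mul, zero_mul,
    Finset.sum_const_zero, add_mul, mul_assoc, Finset.sum_add_distrib, ← Finset.mul_sum]
  ring

/-- The estimate bounds the full 2-jet of `u`. -/
theorem norm_sobolev_le {lam N F : ℝ} (hlam : 0 < lam) (p : sobolevSubmodule n)
    (h : lam * ‖(W22.ofSobolev p).toL2‖ + √lam * (W22.ofSobolev p).gradNorm + (W22.ofSobolev p).hessNorm ≤ N * F)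
    (hNF : 0 ≤ N * F) : ‖p‖ ≤ (N * (lam⁻¹ + (√lam)⁻¹ + 1)) * F := by
  have hs : 0 < √lam := Real.sqrt_pos.2 hlam
  have h0 : 0 ≤ lam * ‖(W22.ofSobolev p).toL2‖ := by positivity
  have h1 : 0 ≤ √lam * (W22.ofSobolev p).gradNorm := mul_nonneg hs.le (Real.sqrt_nonneg _)
  have h2 : 0 ≤ (W22.ofSobolev p).hessNorm := Real.sqrt_nonneg _
  have e : (N * (lam⁻¹ + (√lam)⁻¹ + 1)) * F
      = lam⁻¹ * (N * F) + (√lam)⁻¹ * (N * F) + N * F := by ring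
  have p1 : 0 ≤ lam⁻¹ * (N * F) := by positivity
  have p2 : 0 ≤ (√lam)⁻¹ * (N * F) := by positivity
  have b0 : ‖p.1.1‖ ≤ lam⁻¹ * (N * F) := by
    have h3 : lam * ‖p.1.1‖ ≤ N * F := by
      change lam * ‖(W22.ofSobolev p).toL2‖ ≤ N * F
      linarith
    rwa [le_inv_mul_iff₀ hlam]
  have b1 : ∀ j, ‖p.1.2.1 j‖ ≤ (√lam)⁻¹ * (N * F) := fun j => by
    rw [le_inv_mul_iff₀ hs]
    have : ‖p.1.2.1 j‖ ≤ (W22.ofSobolev p).gradNorm := Real.le_sqrt_of_sq_le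
      (Finset.single_le_sum (f := fun j => ‖(W22.ofSobolev p).grad j‖ ^ 2) (fun _ _ => by positivity)
        (Finset.mem_univ j))
    have := mul_le_mul_of_nonneg_left this hs.le
    linarith
  have b2 : ∀ j k, ‖p.1.2.2 j k‖ ≤ N * F := fun j k => by
    have : ‖p.1.2.2 j k‖ ≤ (W22.ofSobolev p).hessNorm := by
      refine Real.le_sqrt_of_sq_le (le_trans ?_ (Finset.single_le_sum
        (f := fun j => ∑ k, ‖(W22.ofSobolev p).hess j k‖ ^ 2) (fun _ _ => by positivity)
        (Finset.mem_univ j)))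
      exact Finset.single_le_sum (f := fun k => ‖(W22.ofSobolev p).hess j k‖ ^ 2)
        (fun _ _ => by positivity) (Finset.mem_univ k)
    linarith
  rw [e, ← Submodule.norm_coe, norm_prod_le_iff, norm_prod_le_iff]
  refine ⟨by linarith, ?_, ?_⟩
  · exact (pi_norm_le_iff_of_nonneg (by positivity)).2 fun j => (b1 j).trans (by linarith)
  · exact (pi_norm_le_iff_of_nonneg (by positivity)).2 fun j =>
      (pi_norm_le_iff_of_nonneg (by positivity)).2 fun k => (b2 j k).trans (by linarith)

open LineDeriv in
/-- The range of `Δ - λ` is closed by the a priori bound and contains all Schwartz functions. -/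
theorem surjective_laplacian_sub (hδ : 0 < δ) (hδ1 : δ < 1) (hK : 0 ≤ K) {lam C : ℝ}
    (hlam : 0 < lam) (hC : 0 ≤ C)
    (hb : ∀ p, ‖p‖ ≤ C * ‖(coeffAssumption_laplacian n hδ hδ1 hK).toCLM hδ lam p‖) :
    Function.Surjective ((coeffAssumption_laplacian n hδ hδ1 hK).toCLM hδ lam) := by
  set A := (coeffAssumption_laplacian n hδ hδ1 hK).toCLM hδ lam with hA
  have hcl : IsClosed (Set.range A) := by
    have : AntilipschitzWith C.toNNReal A := A.antilipschitz_of_bound fun p => by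
      rw [Real.coe_toNNReal _ hC]; exact hb p
    exact this.isClosed_range A.uniformContinuous
  have hsub : Set.range (SchwartzMap.toLpCLM ℝ ℝ 2 (volume : Measure (Rd n))) ⊆ Set.range A := by
    rintro _ ⟨f, rfl⟩
    obtain ⟨u, hu⟩ := SchwartzMap.exists_sum_lineDeriv_sub_smul_eq hlam f
    refine ⟨u.toW22.toSobolev, ?_⟩
    refine Lp.ext ?_
    have hj : ∀ᵐ x, ∀ j, u.toW22.hess j j x = (∂_{(EuclideanSpace.single j 1 : Rd n)}
        (∂_{(EuclideanSpace.single j 1 : Rd n)} u)) x := by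
      rw [ae_all_iff]
      exact fun j => SchwartzMap.coeFn_toLp _ 2 volume
    filter_upwards [(coeffAssumption_laplacian n hδ hδ1 hK).coeFn_toL2_sub hδ lam u.toW22,
      u.coeFn_toLp 2 volume, f.coeFn_toLp 2 volume, hj] with x h1 h2 h3 h4
    refine h1.trans (Eq.trans ?_ h3.symm)
    have h2' : u.toW22.toL2 x = u x := h2
    rw [h2', ← hu]
    simp [ellipticOp, Matrix.one_apply, h4]
  intro f
  exact hcl.closure_subset_iff.2 hsub
    (SchwartzMap.denseRange_toLpCLM (E := Rd n) (F := ℝ) (p := 2) (by norm_num) f)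

/-- Unique solvability and the a priori estimate for a given modulus of continuity in `x'`. -/
theorem exists_solvability (n : ℕ) {δ K : ℝ} (hδ : 0 < δ) (hδ1 : δ < 1) (hK : 0 < K) :
    ∃ N : ℝ, 0 ≤ N ∧ ∀ w : ℝ → ℝ, Tendsto w (𝓝[≥] 0) (𝓝 0) →
      ∃ lam₀ : ℝ, 0 ≤ lam₀ ∧
      ∀ (a : Rd n → Matrix (Fin (n + 1)) (Fin (n + 1)) ℝ)
        (b : Rd n → Fin (n + 1) → ℝ) (c : Rd n → ℝ),
        CoeffAssumption δ K a b c → HasTailModulus w a →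
        (∀ lam : ℝ, lam₀ < lam → ∀ f : L2Rd n,
          ∃! u : W22 n, (fun x => ellipticOp a b c u x - lam * u.toL2 x) =ᵐ[volume] f) ∧
        (∀ lam : ℝ, lam₀ ≤ lam → ∀ u : W22 n,
          lam * ‖u.toL2‖ + √lam * u.gradNorm + u.hessNorm ≤
            N * (eLpNorm (fun x => ellipticOp a b c u x - lam * u.toL2 x) 2 volume).toReal) := by
  obtain ⟨N, hN, H⟩ := exists_apriori_estimate n hδ hδ1 hK.le
  refine ⟨N, hN, fun w hw => ?_⟩
  obtain ⟨lam₀, hlam₀, H⟩ := H w hw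
  refine ⟨lam₀, hlam₀.le, fun a b c h hwa => ⟨fun lam hlam f => ?_, fun lam hlam u => ?_⟩⟩
  · have hlam0 : 0 < lam := hlam₀.trans hlam
    have hs : 0 < √lam := Real.sqrt_pos.2 hlam0
    set C : ℝ := N * (lam⁻¹ + (√lam)⁻¹ + 1)
    have hC : 0 ≤ C := by positivity
    have bound : ∀ (a : Rd n → Matrix (Fin (n + 1)) (Fin (n + 1)) ℝ)
        (b : Rd n → Fin (n + 1) → ℝ) (c : Rd n → ℝ) (h : CoeffAssumption δ K a b c),
        HasTailModulus w a → ∀ p, ‖p‖ ≤ C * ‖h.toCLM hδ lam p‖ := fun a b c h hwa p =>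
      norm_sobolev_le hlam0 p (H a b c h hwa lam hlam.le (W22.ofSobolev p)) (by positivity)
    have hseg : ∀ t (ht : t ∈ Set.Icc (0 : ℝ) 1) p, ‖p‖ ≤ C * ‖((coeffAssumption_laplacian n hδ hδ1
        hK.le).toCLM hδ lam + t • (h.toCLM hδ lam - (coeffAssumption_laplacian n hδ hδ1
        hK.le).toCLM hδ lam)) p‖ := fun t ht p => by
      rw [← h.toCLM_segment hδ hδ1 hK.le ht]
      exact bound _ _ _ _ (hwa.segment ht) p
    have hsurj : Function.Surjective (h.toCLM hδ lam) := by
      refine ContinuousLinearMap.surjective_of_continuity hC hseg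
        (surjective_laplacian_sub hδ hδ1 hK.le hlam0 hC fun p => ?_)
      simpa using hseg 0 (by simp) p
    obtain ⟨p, hp⟩ := hsurj f
    have hiff : ∀ u : W22 n, (fun x => ellipticOp a b c u x - lam * u.toL2 x) =ᵐ[volume] f ↔
        h.toCLM hδ lam u.toSobolev = f := fun u => by
      constructor
      · intro hu
        exact Lp.ext ((h.coeFn_toL2_sub hδ lam u).trans hu)
      · intro hu
        rw [← hu]
        exact (h.coeFn_toL2_sub hδ lam u).symm
    refine ⟨W22.ofSobolev p, (hiff _).2 hp, fun u hu => W22.ext_toL2 ?_⟩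
    have h1 := bound a b c h hwa (u.toSobolev - p)
    rw [map_sub, (hiff u).1 hu, hp, sub_self, norm_zero, mul_zero] at h1
    have h2 : u.toSobolev = p := sub_eq_zero.1 (norm_le_zero_iff.1 h1)
    rw [← h2]
    rfl
  · have h1 := H a b c h hwa lam hlam u
    rwa [Lp.norm_def (h.toL2 hδ u - lam • u.toL2), eLpNorm_congr_ae (h.coeFn_toL2_sub hδ lam u)] at h1

end

theorem theorem2p2 (n : ℕ) (δ K : ℝ) (hδ0 : 0 < δ) (hδ1 : δ < 1) (hK : 0 < K) :
    -- coefficients `a` independent of `x'`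
    (∃ lam₀ : ℝ, 0 ≤ lam₀ ∧ ∃ N : ℝ, 0 ≤ N ∧
      ∀ (a : Rd n → Matrix (Fin (n + 1)) (Fin (n + 1)) ℝ)
        (b : Rd n → Fin (n + 1) → ℝ) (c : Rd n → ℝ),
        CoeffAssumption δ K a b c → IndepOfTail a →
        (∀ lam : ℝ, lam₀ < lam → ∀ f : L2Rd n,
          ∃! u : W22 n, (fun x => ellipticOp a b c u x - lam * u.toL2 x) =ᵐ[volume] f) ∧
        (∀ lam : ℝ, lam₀ ≤ lam → ∀ u : W22 n,
          lam * ‖u.toL2‖ + √lam * u.gradNorm + u.hessNorm ≤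
            N * (eLpNorm (fun x => ellipticOp a b c u x - lam * u.toL2 x) 2 volume).toReal)) ∧
    -- coefficients `a` uniformly continuous in `x'` uniformly in `x^1`, with modulus `w`
    (∃ N : ℝ, 0 ≤ N ∧ ∀ w : ℝ → ℝ, Tendsto w (𝓝[≥] 0) (𝓝 0) →
      ∃ lam₀ : ℝ, 0 ≤ lam₀ ∧
      ∀ (a : Rd n → Matrix (Fin (n + 1)) (Fin (n + 1)) ℝ)
        (b : Rd n → Fin (n + 1) → ℝ) (c : Rd n → ℝ),
        CoeffAssumption δ K a b c → HasTailModulus w a →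
        (∀ lam : ℝ, lam₀ < lam → ∀ f : L2Rd n,
          ∃! u : W22 n, (fun x => ellipticOp a b c u x - lam * u.toL2 x) =ᵐ[volume] f) ∧
        (∀ lam : ℝ, lam₀ ≤ lam → ∀ u : W22 n,
          lam * ‖u.toL2‖ + √lam * u.gradNorm + u.hessNorm ≤
            N * (eLpNorm (fun x => ellipticOp a b c u x - lam * u.toL2 x) 2 volume).toReal)) := by
  refine ⟨?_, exists_solvability n hδ0 hδ1 hK⟩
  obtain ⟨N, hN, H⟩ := exists_solvability n hδ0 hδ1 hK
  -- Coefficients which do not depend on `x'` have the modulus of continuity `0`.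
  obtain ⟨lam₀, hlam₀, H⟩ := H (fun _ => 0) tendsto_const_nhds
  exact ⟨lam₀, hlam₀, N, hN, fun a b c h ha => H a b c h fun x y hxy j k => by simp [ha x y hxy]⟩
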